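/- Let $D\ge 0$, $N\ge 1$, $T\ge 1$ be integers, $\mathsf X:=\mathbb R^D$ and $[N]_0:=\{0,\dots,N\}$. Write $\mathrm N(x;\mu,\Sigma)$ for the Lebesgue density at $x$ of the Gaussian distribution with mean $\mu$ and covariance matrix $\Sigma$. Quantities with time index $0$ are ignored, so that for instance $Q_1(x_{0:1})=Q_1(x_1)$. For $t=1,\dots,T$ let $Q_t(x_{t-1:t})>0$ and $\phi_t(x_{t-1:t})\in\mathsf X$ be measurable functions of $x_{t-1:t}=(x_{t-1},x_t)\in\mathsf X^2$, let $v_t(x_{t-1})\in\mathsf X$ be a measurable function of $x_{t-1}\in\mathsf X$, let $H_t\in\mathbb R^{D\times D}$, and let $E_t,D_t\in\mathbb R^{D\times D}$ be symmetric and positive definite. Assume that $\prod_{t=1}^T Q_t(x_{t-1:t})$ is Lebesgue integrable on $\mathsf X^T$, and let $\pi_T$ be the probability distribution on $\mathsf X^T$ with density $\pi_T(x_{1:T})\propto\prod_{t=1}^T Q_t(x_{t-1:t})$. Put $M'_t(x_t\mid x_{t-1};u_t):=\mathrm N(x_t;\,v_t(x_{t-1})+H_tu_t,\,D_t)$. For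 particles $x_t^0,\dots,x_t^N\in\mathsf X$ with ancestor indices $a_{t-1}^0,\dots,a_{t-1}^N\in[N]_0$ write $x_{t-1:t}^{(n)}:=(x_{t-1}^{a_{t-1}^n},x_t^n)$ and $x_t^{-n}:=(x_t^m)_{m\ne n}$, let $\mathcal H_{t-1}$ be the particles and ancestor indices that determine $x_{t-1}^{a_{t-1}^0},\dots,x_{t-1}^{a_{t-1}^N}$, and define $$q_t^{-n}(x_t^{-n}\mid x_t^n;\mathcal H_{t-1}):=\int_{\mathsf X}\mathrm N\bigl(u;\,x_t^n+\phi_t(x_{t-1:t}^{(n)}),\,E_t\bigr)\prod_{m\ne n}M'_t\bigl(x_t^m\mid x_{t-1}^{a_{t-1}^m};u\bigr)\,du .$$ The generic marginal algorithm does the following, given $x_{1:T}\in\mathsf X^T$. 1. For $t=1,\dots,T$: (a) sample $k_t$ uniformly from $[N]_0$ and set $x_t^{k_t}:=x_t$; (b) if $t>1$, set $a_{t-1}^{k_t}:=k_{t-1}$ and, independently for $n\in[N]_0\setminus\{k_t\}$, sample $a_{t-1}^n=i$ with probability $W_{t-1}^i$; (c) sample $x_t^{-k_t}\sim q_t^{-k_t}(\,\cdot\mid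 x_t^{k_t};\mathcal H_{t-1})$; (d) for $n\in[N]_0$, set $w_t^n:=Q_t(x_{t-1:t}^{(n)})\,q_t^{-n}(x_t^{-n}\mid x_t^n;\mathcal H_{t-1})$ and $W_t^n:=w_t^n/\sum_{m=0}^N w_t^m$. 2. Sample $i\in[N]_0\setminus\{k_T\}$ with probability $W_T^i/(1-W_T^{k_T})$; set $l_T:=i$ with probability $1\wedge\frac{1-W_T^{k_T}}{1-W_T^i}$, and otherwise set $l_T:=k_T$. 3. For $t=T-1,\dots,1$, sample $l_t=i\in[N]_0$ with probability $W_t^iQ_{t+1}(x_t^i,x_{t+1}^{l_{t+1}})\big/\sum_{n=0}^N W_t^nQ_{t+1}(x_t^n,x_{t+1}^{l_{t+1}})$. 4. Return $x'_{1:T}:=(x_1^{l_1},\dots,x_T^{l_T})$. **Proposition.** Sampling $x'_{1:T}$ given $x_{1:T}$ by this algorithm induces a Markov kernel $P(\,\cdot\mid x_{1:T})$ on $\mathsf X^T$, and $P$ leaves the probability distribution $\pi_T$ invariant. -/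

import Mathlib

open MeasureTheory ProbabilityTheory
open scoped ENNReal

namespace MarginalCSMC

noncomputable section

/-- The state space `ℝ^D`. -/
abbrev State (D : ℕ) : Type := EuclideanSpace ℝ (Fin D)

/-- The Lebesgue density at `x` of the Gaussian distribution on `ℝ^D` with mean `μ` and
(positive definite) covariance matrix `S`. -/
def gaussianDensity {D : ℕ} (μ : State D) (S : Matrix (Fin D) (Fin D) ℝ) (x : State D) : ℝ :=
  (Real.sqrt ((2 * Real.pi) ^ D * S.det))⁻¹ *
    Real.exp (-(1 / 2) * inner ℝ (x - μ) (Matrix.toEuclideanCLM (𝕜 := ℝ) S⁻¹ (x - μ)))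

/-- The data of the Feynman--Kac model and of the Gaussian proposals. Times are `t = 1, …, T`
(the values of the fields at other times are never used), and `x₀ := 0` is a dummy, so that a
function of `(x₀, x₁)` is the same thing as a function of `x₁`. -/
structure Model (D : ℕ) where
  /-- `Q t x y` is `Q_t(x_{t-1:t})` at `x_{t-1} = x`, `x_t = y`. -/
  Q : ℕ → State D → State D → ℝ
  /-- `phi t x y` is `φ_t(x_{t-1:t})` at `x_{t-1} = x`, `x_t = y`. -/
  phi : ℕ → State D → State D → State D
  /-- `E t` is the covariance matrix of the auxiliary variable `u_t`. -/
  E : ℕ → Matrix (Fin D) (Fin D) ℝ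
  /-- `v t x` is `v_t(x_{t-1})` at `x_{t-1} = x`. -/
  v : ℕ → State D → State D
  /-- `H t` is the matrix that multiplies `u_t` in the mean of the mutation kernel. -/
  H : ℕ → Matrix (Fin D) (Fin D) ℝ
  /-- `Dm t` is the covariance matrix `D_t` of the mutation kernel. -/
  Dm : ℕ → Matrix (Fin D) (Fin D) ℝ

/-- The unnormalised target density `∏_{t=1}^T Q_t(x_{t-1:t})`. The factor with index `i : Fin T`
belongs to time `i + 1`; `Fin.cons 0 x` is the sequence `x₀ = 0, x₁, …, x_T`. -/
def unnormalisedTarget {D : ℕ} (M : Model D) (T : ℕ) (x : Fin T → State D) : ℝ :=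
  ∏ i : Fin T, M.Q ((i : ℕ) + 1) ((Fin.cons 0 x : Fin (T + 1) → State D) i.castSucc) (x i)

/-- The joint smoothing distribution `π_T` on `(ℝ^D)^T`. -/
def target {D : ℕ} (M : Model D) (T : ℕ) : Measure (Fin T → State D) :=
  (∫⁻ x : Fin T → State D, ENNReal.ofReal (unnormalisedTarget M T x))⁻¹ •
    (volume : Measure (Fin T → State D)).withDensity
      (fun x => ENNReal.ofReal (unnormalisedTarget M T x))

/-- The density `M'_t(y | x; u)` of the mutation kernel,
i.e. of the Gaussian with mean `v_t(x) + H_t u` and covariance `D_t`. -/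
def mutationDensity {D : ℕ} (M : Model D) (t : ℕ) (x u y : State D) : ℝ :=
  gaussianDensity (M.v t x + Matrix.toEuclideanCLM (𝕜 := ℝ) (M.H t) u) (M.Dm t) y

/-- The joint proposal density `q_t^{-n}(x_t^{-n}, u | x_t^n; H_{t-1})`, where `y m` is the parent
`x_{t-1}^{a_{t-1}^m}` of the `m`-th particle and `z m` is the `m`-th particle `x_t^m`. -/
def jointProposalDensity {D N : ℕ} (M : Model D) (t : ℕ) (n : Fin (N + 1))
    (y z : Fin (N + 1) → State D) (u : State D) : ℝ :=
  gaussianDensity (z n + M.phi t (y n) (z n)) (M.E t) u *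
    ∏ m ∈ Finset.univ.erase n, mutationDensity M t (y m) u (z m)

/-- The marginal proposal density `q_t^{-n}(x_t^{-n} | x_t^n; H_{t-1})`: the auxiliary variable is
integrated out. -/
def proposalDensity {D N : ℕ} (M : Model D) (t : ℕ) (n : Fin (N + 1))
    (y z : Fin (N + 1) → State D) : ℝ≥0∞ :=
  ∫⁻ u : State D, ENNReal.ofReal (jointProposalDensity M t n y z u)

/-- Normalisation of weights: `w^n / ∑_m w^m`. -/
def normalise {N : ℕ} (w : Fin (N + 1) → ℝ≥0∞) (n : Fin (N + 1)) : ℝ≥0∞ :=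
  w n / ∑ m, w m

/-- The law of an index that equals `i` with probability `w^i / ∑_m w^m`. -/
def categorical {N : ℕ} (w : Fin (N + 1) → ℝ≥0∞) : Measure (Fin (N + 1)) :=
  ∑ i, normalise w i • Measure.dirac i

/-- The uniform distribution on the indices `0, …, N`. -/
def uniformIndex (N : ℕ) : Measure (Fin (N + 1)) :=
  ∑ i, ((N : ℝ≥0∞) + 1)⁻¹ • Measure.dirac i

/-- One time step of the particle system: the index `k_t` of the reference particle, the
particles `x_t^0, …, x_t^N` and their unnormalised weights `w_t^0, …, w_t^N`. -/
abbrev Generation (D N : ℕ) : Type :=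
  Fin (N + 1) × (Fin (N + 1) → State D) × (Fin (N + 1) → ℝ≥0∞)

/-- The index of the reference particle. -/
def Generation.refIndex {D N : ℕ} (g : Generation D N) : Fin (N + 1) := g.1

/-- The particles. -/
def Generation.particle {D N : ℕ} (g : Generation D N) : Fin (N + 1) → State D := g.2.1

/-- The normalised weights `W_t^n = w_t^n / ∑_m w_t^m`. -/
def Generation.weight {D N : ℕ} (g : Generation D N) : Fin (N + 1) → ℝ≥0∞ := normalise g.2.2

/-- The law of the ancestor indices `a = (a_{t-1}^0, …, a_{t-1}^N)`, given the generation `g` at time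
`t - 1` and `k = k_t`: the `k`-th index is `k_{t-1}`, and the others are independent draws that
equal `i` with probability `W_{t-1}^i`. -/
def ancestorLaw {D N : ℕ} (g : Generation D N) (k : Fin (N + 1)) :
    Measure (Fin (N + 1) → Fin (N + 1)) :=
  ∑ a : Fin (N + 1) → Fin (N + 1),
    ((if a k = g.refIndex then 1 else 0) * ∏ n ∈ Finset.univ.erase k, g.weight (a n)) •
      Measure.dirac a

/-- The law of the vector of parents `x_{t-1}^{a_{t-1}^n}`. At time `t = 1` there are no ancestor
indices, and all parents are the dummy `x₀ = 0`; then `g` is ignored. -/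
def parentLaw {D N : ℕ} (t : ℕ) (g : Generation D N) (k : Fin (N + 1)) :
    Measure (Fin (N + 1) → State D) :=
  if 1 < t then (ancestorLaw g k).map (fun a n => g.particle (a n))
  else Measure.dirac (fun _ => 0)

/-- The law of the particles at time `t`, given the parents `y`: the `k`-th particle is the
reference state `x`, and the other ones, as an element of `(ℝ^D)^N`, are drawn from the marginal
proposal density. -/
def particleLaw {D N : ℕ} (M : Model D) (t : ℕ) (k : Fin (N + 1)) (y : Fin (N + 1) → State D)
    (x : State D) : Measure (Fin (N + 1) → State D) :=
  ((volume : Measure (Fin N → State D)).withDensity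
      (fun z => proposalDensity M t k y (k.insertNth (α := fun _ => State D) x z))).map
    (fun z => k.insertNth (α := fun _ => State D) x z)

/-- The unnormalised weight `w_t^n = Q_t(x_{t-1:t}^{(n)}) q_t^{-n}(x_t^{-n} | x_t^n; H_{t-1})`. -/
def unnormalisedWeight {D N : ℕ} (M : Model D) (t : ℕ) (y z : Fin (N + 1) → State D)
    (n : Fin (N + 1)) : ℝ≥0∞ :=
  ENNReal.ofReal (M.Q t (y n) (z n)) * proposalDensity M t n y z

/-- The law of the generation at time `t`, given the generation `g` at time `t - 1` and the
reference state `x = x_t`: sample `k_t` uniformly, then the ancestor indices, then the particles;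
finally compute the weights. -/
def generationLaw {D N : ℕ} (M : Model D) (t : ℕ) (g : Generation D N) (x : State D) :
    Measure (Generation D N) :=
  (uniformIndex N).bind fun k =>
    (parentLaw t g k).bind fun y =>
      (particleLaw M t k y x).map fun z =>
        ((k, z, unnormalisedWeight M t y z) : Generation D N)

/-- The forced-move update at the final time, with normalised weights `W`: sample `i ≠ k` with
probability `W^i / (1 - W^k)`; return `i` with probability `min 1 ((1 - W^k) / (1 - W^i))`, and `k`
otherwise. -/
def forcedMove {N : ℕ} (W : Fin (N + 1) → ℝ≥0∞) (k : Fin (N + 1)) : Measure (Fin (N + 1)) :=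
  ∑ i ∈ Finset.univ.erase k, (W i / (1 - W k)) •
    (min 1 ((1 - W k) / (1 - W i)) • Measure.dirac i +
      (1 - min 1 ((1 - W k) / (1 - W i))) • Measure.dirac k)

/-- Backward sampling at time `t`, given the state `x' = x_{t+1}^{l_{t+1}}` selected at time
`t + 1`: the index is `i` with probability proportional to `W_t^i Q_{t+1}(x_t^i, x')`. -/
def backwardLaw {D N : ℕ} (M : Model D) (t : ℕ) (g : Generation D N) (x' : State D) :
    Measure (Fin (N + 1)) :=
  categorical fun i => g.weight i * ENNReal.ofReal (M.Q (t + 1) (g.particle i) x')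

/-- The algorithm at the times `t, t + 1, …, t + r - 1` (the last of these is the final time `T`),
given the generation `g` at time `t - 1` and the reference states at these times; the value is the
law of the returned states `x'_t, …, x'_T`. A step samples the generation at time `t`, runs the
algorithm at the later times, and then selects the index `l_t`: by the forced move if `t = T`, by
backward sampling given `x'_{t+1} = x_{t+1}^{l_{t+1}}` if `t < T`. Thus the generations are
sampled for `t = 1, …, T`, and after that the indices are selected for `t = T, …, 1`. -/
def runFrom {D N : ℕ} (M : Model D) : (r t : ℕ) → Generation D N → (Fin r → State D) →
    Measure (Fin r → State D)
  | 0, _, _, _ => Measure.dirac Fin.elim0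
  | 1, t, g, x =>
      (generationLaw M t g (x 0)).bind fun h =>
        (forcedMove h.weight h.refIndex).map fun l => fun _ => h.particle l
  | r + 2, t, g, x =>
      (generationLaw M t g (x 0)).bind fun h =>
        (runFrom M (r + 1) (t + 1) h (Fin.tail x)).bind fun x' =>
          (backwardLaw M t h (x' 0)).map fun l =>
            (Fin.cons (h.particle l) x' : Fin (r + 2) → State D)

/-- The law of the output `x'_{1:T}` of the generic marginal algorithm with `N` proposals per time
step, given the reference path `x_{1:T}`. There is no generation before time `1`; the argument in
its place is a dummy that is never used. -/
def algorithmLaw {D : ℕ} (M : Model D) (N T : ℕ) (x : Fin T → State D) :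
    Measure (Fin T → State D) :=
  runFrom (N := N) M T 1 (0, 0, 0) x

end

end MarginalCSMC

/-! The proof exhibits an extended target in which the reference indices are auxiliary variables.
Suppose that `k_{t-1}` is distributed according to the weights `W_{t-1}` and that the reference
state has density `Q_t(x_{t-1}^{k_{t-1}}, ·)`. Setting the ancestor of particle `k_t` to `k_{t-1}`
supplies exactly the factor that its own draw would have contributed, so the ancestor indices get
the symmetric probability `∏_n W_{t-1}^{a^n}` (`weight_mul_ancestorProb`). The reference density
times the proposal density of the other particles is `Q_t q_t^{-k} = w_t^k`. Hence the joint law of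
ancestors, particles and `k_t` is proportional to `∏_n W_{t-1}^{a^n} · w_t^{k_t}`: given the
particles, `k_t` is again distributed according to the weights
(`Model.Regular.sum_lintegral_generationLaw`).

This makes an induction on the number of remaining steps possible, with `PathInvariance` as its
statement. At the final time, the index is updated by a Metropolis move that is reversible for `W_T`
(`sum_forcedMove`). At an earlier time, the induction hypothesis handles the later states, and
backward sampling is then a Gibbs update: it redraws the index from its conditional law given the
later states (`sum_mul_backwardProb`). The start is a dummy generation whose particles are all `0`.

All integrals are taken in `ℝ≥0∞` against unnormalised densities, so Tonelli applies throughout;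
integrability of the target matters only for its normalisation. The Gaussian form enters only
through measurability, positivity, boundedness and total mass one, which make the weights positive
and finite and the proposal a probability density.

Since `normalise` may lose mass at degenerate weights, the laws are only sub-probabilities for
arbitrary generations. That suffices for measurability; mass one is proved separately for
nondegenerate generations. -/

namespace MarginalCSMC

/-! ### Gaussian densities: positivity, boundedness, total mass. -/

section Gaussian

variable {D : ℕ} {S : Matrix (Fin D) (Fin D) ℝ}

lemma measurable_gaussianDensity (S : Matrix (Fin D) (Fin D) ℝ) :
    Measurable fun p : State D × State D => gaussianDensity p.1 S p.2 := by
  refine Continuous.measurable ?_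
  unfold gaussianDensity
  fun_prop

lemma gaussianDensity_pos (hS : S.PosDef) (μ x : State D) : 0 < gaussianDensity μ S x := by
  have := hS.det_pos
  unfold gaussianDensity
  positivity

lemma inner_toEuclideanCLM_star_mul_self (B : Matrix (Fin D) (Fin D) ℝ) (x : State D) :
    inner ℝ x (Matrix.toEuclideanCLM (𝕜 := ℝ) (star B * B) x) =
      ‖Matrix.toEuclideanCLM (𝕜 := ℝ) B x‖ ^ 2 := by
  rw [map_mul, map_star, mul_apply_eq_comp, ContinuousLinearMap.star_eq_adjoint,
    ContinuousLinearMap.adjoint_inner_right, real_inner_self_eq_norm_sq]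

/-- Turns the exponent into `-‖B (x - μ)‖² / 2`, which gives both the upper bound on the density and
the reduction to a standard Gaussian. -/
lemma exists_inv_eq_star_mul_self (hS : S.PosDef) :
    ∃ B : Matrix (Fin D) (Fin D) ℝ, B.det ≠ 0 ∧ S⁻¹ = star B * B := by
  open scoped MatrixOrder Matrix.Norms.L2Operator in
  obtain ⟨B, hB, h⟩ := CStarAlgebra.isStrictlyPositive_iff_eq_star_mul_self.mp
    hS.inv.isStrictlyPositive
  exact ⟨B, ((Matrix.isUnit_iff_isUnit_det B).mp hB).ne_zero, h⟩

lemma gaussianDensity_le (hS : S.PosDef) (μ x : State D) :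
    gaussianDensity μ S x ≤ (Real.sqrt ((2 * Real.pi) ^ D * S.det))⁻¹ := by
  obtain ⟨B, -, h⟩ := exists_inv_eq_star_mul_self hS
  unfold gaussianDensity
  rw [h, inner_toEuclideanCLM_star_mul_self]
  refine mul_le_of_le_one_right (by positivity) (Real.exp_le_one_iff.mpr ?_)
  nlinarith [sq_nonneg ‖Matrix.toEuclideanCLM (𝕜 := ℝ) B (x - μ)‖]

lemma lintegral_exp_neg_half_norm_sq :
    ∫⁻ x : State D, ENNReal.ofReal (Real.exp (-(1 / 2) * ‖x‖ ^ 2)) =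
      ENNReal.ofReal (Real.sqrt ((2 * Real.pi) ^ D)) := by
  have h := GaussianFourier.integral_rexp_neg_mul_sq_norm (V := State D) (b := 1 / 2) (by norm_num)
  have h' : (Real.pi / (1 / 2)) ^ ((Module.finrank ℝ (State D) : ℝ) / 2) =
      Real.sqrt ((2 * Real.pi) ^ D) := by
    rw [finrank_euclideanSpace_fin, Real.sqrt_eq_rpow, ← Real.rpow_natCast,
      ← Real.rpow_mul (by positivity)]
    congr 1 <;> ring
  rw [h'] at h
  rw [← h, ofReal_integral_eq_lintegral_ofReal]
  -- The Bochner integral of a non-integrable function is `0`, so the positive value computed above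
  -- already gives integrability.
  · refine Integrable.of_integral_ne_zero ?_
    rw [h]
    positivity
  · exact Filter.Eventually.of_forall fun _ => (Real.exp_pos _).le

/-- Translation removes the mean, and the linear change of variables by `B` leads to the standard
Gaussian; its Jacobian `|det B|⁻¹ = √(det S)` cancels against the normalising constant. -/
lemma lintegral_gaussianDensity (hS : S.PosDef) (μ : State D) :
    ∫⁻ x, ENNReal.ofReal (gaussianDensity μ S x) = 1 := by
  obtain ⟨B, hB, h⟩ := exists_inv_eq_star_mul_self hS
  have hdet : S.det⁻¹ = B.det ^ 2 := by
    have := congrArg Matrix.det h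
    rw [Matrix.det_nonsing_inv, Matrix.det_mul, Matrix.star_eq_conjTranspose,
      Matrix.det_conjTranspose, Ring.inverse_eq_inv] at this
    simpa [sq] using this
  let f : State D →ₗ[ℝ] State D := Matrix.toLpLin 2 2 B
  have hf : LinearMap.det f = B.det := LinearMap.det_toLpLin 2 B
  have hsub : ∫⁻ x, ENNReal.ofReal (gaussianDensity μ S x) =
      ∫⁻ x, ENNReal.ofReal (gaussianDensity 0 S x) := by
    rw [← lintegral_sub_right_eq_self (fun x => ENNReal.ofReal (gaussianDensity 0 S x)) μ]
    simp only [gaussianDensity, sub_zero]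
  have hg : ∀ x : State D, ENNReal.ofReal (gaussianDensity 0 S x) =
      ENNReal.ofReal (Real.sqrt ((2 * Real.pi) ^ D * S.det))⁻¹ *
        ENNReal.ofReal (Real.exp (-(1 / 2) * ‖f x‖ ^ 2)) := by
    intro x
    rw [← ENNReal.ofReal_mul (by positivity), gaussianDensity, h,
      inner_toEuclideanCLM_star_mul_self, sub_zero]
    rfl
  have hmeas : Measurable fun x : State D => ENNReal.ofReal (Real.exp (-(1 / 2) * ‖x‖ ^ 2)) := by
    fun_prop
  rw [hsub, lintegral_congr hg, lintegral_const_mul' _ _ ENNReal.ofReal_ne_top,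
    ← lintegral_map (f := fun x : State D => ENNReal.ofReal (Real.exp (-(1 / 2) * ‖x‖ ^ 2))) hmeas
      f.continuous_of_finiteDimensional.measurable,
    Measure.map_linearMap_addHaar_eq_smul_addHaar volume (hf ▸ hB), lintegral_smul_measure,
    lintegral_exp_neg_half_norm_sq, smul_eq_mul, ← ENNReal.ofReal_mul (by positivity),
    ← ENNReal.ofReal_mul (by positivity), ← ENNReal.ofReal_one, hf]
  congr 1
  have hBS : |B.det⁻¹| = Real.sqrt S.det := by
    rw [← Real.sqrt_sq_eq_abs, inv_pow, ← hdet, inv_inv]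
  have := hS.det_pos
  rw [hBS, Real.sqrt_mul (by positivity)]
  have h1 : 0 < Real.sqrt ((2 * Real.pi) ^ D) := by positivity
  have h2 : 0 < Real.sqrt S.det := by positivity
  field_simp

end Gaussian

/-! ### Tonelli on finite powers of a measure space. -/

section PiIntegrals

variable {X : Type*} [MeasureSpace X]

lemma measurable_insertNth {n : ℕ} (k : Fin (n + 1)) :
    Measurable fun p : X × (Fin n → X) => (k.insertNth (α := fun _ => X) p.1 p.2) :=
  (MeasurableEquiv.piFinSuccAbove (fun _ : Fin (n + 1) => X) k).symm.measurable

lemma measurable_cons {n : ℕ} :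
    Measurable fun p : X × (Fin n → X) => (Fin.cons p.1 p.2 : Fin (n + 1) → X) := by
  simpa only [Fin.insertNth_zero'] using measurable_insertNth (X := X) (0 : Fin (n + 1))

lemma lintegral_pi_fin_zero (f : (Fin 0 → X) → ℝ≥0∞) : ∫⁻ z, f z = f Fin.elim0 := by
  rw [volume_pi, Measure.pi_of_empty, lintegral_dirac]
  exact congrArg f (Subsingleton.elim _ _)

variable [SigmaFinite (volume : Measure X)]

lemma lintegral_insertNth {n : ℕ} (k : Fin (n + 1)) {f : (Fin (n + 1) → X) → ℝ≥0∞}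
    (hf : Measurable f) :
    ∫⁻ z, f z = ∫⁻ x, ∫⁻ z, f (k.insertNth (α := fun _ => X) x z) := by
  have h := (volume_preserving_piFinSuccAbove (fun _ : Fin (n + 1) => X) k).symm
  rw [← h.lintegral_comp hf, Measure.volume_eq_prod, lintegral_prod]
  · rfl
  · exact (hf.comp (measurable_insertNth k)).aemeasurable

lemma lintegral_cons {n : ℕ} {f : (Fin (n + 1) → X) → ℝ≥0∞} (hf : Measurable f) :
    ∫⁻ z, f z = ∫⁻ x, ∫⁻ z, f (Fin.cons x z : Fin (n + 1) → X) := by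
  simpa only [Fin.insertNth_zero'] using lintegral_insertNth 0 hf

lemma lintegral_fin_prod : ∀ {n : ℕ} {f : Fin n → X → ℝ≥0∞} (_ : ∀ i, Measurable (f i)),
    ∫⁻ z : Fin n → X, ∏ i, f i (z i) = ∏ i, ∫⁻ x, f i x
  | 0, f, _ => by rw [lintegral_pi_fin_zero]; simp
  | n + 1, f, hf => by
    rw [lintegral_cons (by fun_prop), Fin.prod_univ_succ, ← lintegral_mul_const _ (hf 0)]
    refine lintegral_congr fun x => ?_
    simp only [Fin.prod_univ_succ, Fin.cons_zero, Fin.cons_succ]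
    rw [lintegral_const_mul _ (by fun_prop), lintegral_fin_prod fun i => hf i.succ]

end PiIntegrals

lemma prod_erase_eq_prod_succAbove {β : Type*} [CommMonoid β] {n : ℕ} (k : Fin (n + 1))
    (f : Fin (n + 1) → β) :
    ∏ m ∈ Finset.univ.erase k, f m = ∏ i : Fin n, f (k.succAbove i) := by
  rw [← Finset.compl_singleton, ← Fin.image_succAbove_univ,
    Finset.prod_image fun _ _ _ _ h => Fin.succAbove_right_injective h]

/-- The assumptions on the model at time `t`. -/
structure Model.Regular {D : ℕ} (M : Model D) (t : ℕ) : Prop where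
  Q_pos : ∀ x y, 0 < M.Q t x y
  measurable_Q : Measurable (Function.uncurry (M.Q t))
  measurable_phi : Measurable (Function.uncurry (M.phi t))
  measurable_v : Measurable (M.v t)
  posDef_E : (M.E t).PosDef
  posDef_Dm : (M.Dm t).PosDef

/-! ### The marginal proposal density and the weights. -/

section Proposal

variable {D N : ℕ} {M : Model D} {t : ℕ}

lemma Model.Regular.measurable_Q_comp (hM : M.Regular t) {α : Type*} [MeasurableSpace α]
    {f g : α → State D} (hf : Measurable f) (hg : Measurable g) :
    Measurable fun a => ENNReal.ofReal (M.Q t (f a) (g a)) :=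
  (hM.measurable_Q.comp (hf.prodMk hg)).ennreal_ofReal

lemma Model.Regular.measurable_jointProposalDensity (hM : M.Regular t) (n : Fin (N + 1)) :
    Measurable fun p : ((Fin (N + 1) → State D) × (Fin (N + 1) → State D)) × State D =>
      jointProposalDensity M t n p.1.1 p.1.2 p.2 := by
  unfold jointProposalDensity mutationDensity
  have hv := hM.measurable_v
  have hphi : Measurable fun p : ((Fin (N + 1) → State D) × (Fin (N + 1) → State D)) × State D =>
      M.phi t (p.1.1 n) (p.1.2 n) :=
    hM.measurable_phi.comp (f := fun p : ((Fin (N + 1) → State D) × (Fin (N + 1) → State D)) ×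
      State D => (p.1.1 n, p.1.2 n)) (by fun_prop)
  refine Measurable.mul ?_ (Finset.measurable_prod _ fun m _ => ?_)
  · exact (measurable_gaussianDensity (M.E t)).comp
      (f := fun p : ((Fin (N + 1) → State D) × (Fin (N + 1) → State D)) × State D =>
        (p.1.2 n + M.phi t (p.1.1 n) (p.1.2 n), p.2)) (by fun_prop)
  · exact (measurable_gaussianDensity (M.Dm t)).comp
      (f := fun p : ((Fin (N + 1) → State D) × (Fin (N + 1) → State D)) × State D =>
        (M.v t (p.1.1 m) + Matrix.toEuclideanCLM (𝕜 := ℝ) (M.H t) p.2, p.1.2 m)) (by fun_prop)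

lemma Model.Regular.measurable_proposalDensity (hM : M.Regular t) (n : Fin (N + 1)) :
    Measurable fun p : (Fin (N + 1) → State D) × (Fin (N + 1) → State D) =>
      proposalDensity M t n p.1 p.2 :=
  (hM.measurable_jointProposalDensity n).ennreal_ofReal.lintegral_prod_right'

lemma Model.Regular.measurable_proposalDensity_comp (hM : M.Regular t) (n : Fin (N + 1))
    {α : Type*} [MeasurableSpace α] {f g : α → Fin (N + 1) → State D} (hf : Measurable f)
    (hg : Measurable g) : Measurable fun a => proposalDensity M t n (f a) (g a) := by
  have h := (hM.measurable_proposalDensity n).comp (hf.prodMk hg)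
  exact h

lemma Model.Regular.mutationDensity_pos (hM : M.Regular t) (x u y : State D) :
    0 < mutationDensity M t x u y :=
  gaussianDensity_pos hM.posDef_Dm _ _

lemma Model.Regular.proposalDensity_ne_zero (hM : M.Regular t) (n : Fin (N + 1))
    (y z : Fin (N + 1) → State D) : proposalDensity M t n y z ≠ 0 := by
  unfold proposalDensity
  have hm := ((hM.measurable_jointProposalDensity n).comp
    (measurable_prodMk_left (x := (y, z)))).ennreal_ofReal
  refine ((lintegral_pos_iff_support hm).mpr ?_).ne'
  have : (Function.support fun u => ENNReal.ofReal (jointProposalDensity M t n y z u)) =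
      Set.univ := by
    refine Set.eq_univ_of_forall fun u => ?_
    simp only [Function.mem_support, ne_eq, ENNReal.ofReal_eq_zero, not_le]
    exact mul_pos (gaussianDensity_pos hM.posDef_E _ _)
      (Finset.prod_pos fun m _ => hM.mutationDensity_pos _ _ _)
  exact this ▸ Measure.measure_univ_pos.mpr (NeZero.ne _)

/-- The mutation densities are bounded uniformly in `u`; what remains is a Gaussian density in `u`
of mass one. -/
lemma Model.Regular.proposalDensity_ne_top (hM : M.Regular t) (n : Fin (N + 1))
    (y z : Fin (N + 1) → State D) : proposalDensity M t n y z ≠ ∞ := by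
  let C : ℝ := (Real.sqrt ((2 * Real.pi) ^ D * (M.Dm t).det))⁻¹
  let C' : ℝ := ∏ m ∈ Finset.univ.erase n, C
  have hle : ∀ u, ENNReal.ofReal (jointProposalDensity M t n y z u) ≤
      ENNReal.ofReal (gaussianDensity (z n + M.phi t (y n) (z n)) (M.E t) u) *
        ENNReal.ofReal C' := by
    intro u
    rw [← ENNReal.ofReal_mul (gaussianDensity_pos hM.posDef_E _ _).le]
    refine ENNReal.ofReal_le_ofReal (mul_le_mul_of_nonneg_left ?_
      (gaussianDensity_pos hM.posDef_E _ _).le)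
    exact Finset.prod_le_prod (fun m _ => (hM.mutationDensity_pos _ _ _).le)
      fun m _ => gaussianDensity_le hM.posDef_Dm _ _
  refine ne_top_of_le_ne_top ?_ (lintegral_mono hle)
  rw [lintegral_mul_const' _ _ ENNReal.ofReal_ne_top, lintegral_gaussianDensity hM.posDef_E,
    one_mul]
  exact ENNReal.ofReal_ne_top

/-- Given `u`, the other particles are independent with densities of mass one; so integrate over
them first, then over `u`. -/
lemma Model.Regular.lintegral_proposalDensity (hM : M.Regular t) (k : Fin (N + 1))
    (y : Fin (N + 1) → State D) (x : State D) :
    ∫⁻ z, proposalDensity M t k y (k.insertNth (α := fun _ => State D) x z) = 1 := by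
  have hmeas : Measurable fun p : (Fin N → State D) × State D =>
      ENNReal.ofReal (jointProposalDensity M t k y
        (k.insertNth (α := fun _ => State D) x p.1) p.2) :=
    ((hM.measurable_jointProposalDensity k).comp ((measurable_const.prodMk
      ((measurable_insertNth k).comp (measurable_const.prodMk measurable_fst))).prodMk
        measurable_snd)).ennreal_ofReal
  unfold proposalDensity
  rw [lintegral_lintegral_swap hmeas.aemeasurable, ← lintegral_gaussianDensity hM.posDef_E
    (x + M.phi t (y k) x)]
  refine lintegral_congr fun u => ?_
  have hprod : ∀ z : Fin N → State D, ENNReal.ofReal (jointProposalDensity M t k y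
      (k.insertNth (α := fun _ => State D) x z) u) =
      ENNReal.ofReal (gaussianDensity (x + M.phi t (y k) x) (M.E t) u) *
        ∏ i, ENNReal.ofReal (mutationDensity M t (y (k.succAbove i)) u (z i)) := by
    intro z
    rw [jointProposalDensity, prod_erase_eq_prod_succAbove,
      ENNReal.ofReal_mul (gaussianDensity_pos hM.posDef_E _ _).le,
      ENNReal.ofReal_prod_of_nonneg fun m _ => (hM.mutationDensity_pos _ _ _).le]
    simp
  rw [lintegral_congr hprod, lintegral_const_mul' _ _ ENNReal.ofReal_ne_top,
    lintegral_fin_prod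
      (f := fun i x => ENNReal.ofReal (mutationDensity M t (y (k.succAbove i)) u x))
      fun i => ((measurable_gaussianDensity (M.Dm t)).comp measurable_prodMk_left).ennreal_ofReal]
  simp [mutationDensity, lintegral_gaussianDensity hM.posDef_Dm]

lemma Model.Regular.measurable_unnormalisedWeight_comp (hM : M.Regular t)
    {α : Type*} [MeasurableSpace α] {f g : α → Fin (N + 1) → State D} (hf : Measurable f)
    (hg : Measurable g) : Measurable fun a => unnormalisedWeight M t (f a) (g a) := by
  refine measurable_pi_lambda _ fun n => ?_
  exact (hM.measurable_Q_comp (by fun_prop) (by fun_prop)).mul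
    (hM.measurable_proposalDensity_comp n hf hg)

lemma Model.Regular.unnormalisedWeight_ne_zero (hM : M.Regular t)
    (y z : Fin (N + 1) → State D) (n : Fin (N + 1)) : unnormalisedWeight M t y z n ≠ 0 :=
  mul_ne_zero (ENNReal.ofReal_pos.mpr (hM.Q_pos _ _)).ne' (hM.proposalDensity_ne_zero n y z)

lemma Model.Regular.unnormalisedWeight_ne_top (hM : M.Regular t)
    (y z : Fin (N + 1) → State D) (n : Fin (N + 1)) : unnormalisedWeight M t y z n ≠ ∞ :=
  ENNReal.mul_ne_top ENNReal.ofReal_ne_top (hM.proposalDensity_ne_top n y z)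

end Proposal

/-! ### Measurability of parametrised integrals and compositions. -/

section Parametrised

variable {α β γ : Type*} [MeasurableSpace α] [MeasurableSpace β] [MeasurableSpace γ]

lemma measurable_measure_of_lintegral {κ : α → Measure β}
    (h : ∀ F : β → ℝ≥0∞, Measurable F → Measurable fun a => ∫⁻ b, F b ∂κ a) : Measurable κ := by
  refine Measure.measurable_of_measurable_coe _ fun s hs => ?_
  simpa only [lintegral_indicator_one hs] using h (s.indicator 1) (measurable_one.indicator hs)

/-- The mass bound makes `κ` a finite kernel, which allows the integrand to depend on the parameter
too. -/
lemma measurable_lintegral_of_subprobability {κ : α → Measure β} (hκ : Measurable κ)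
    (hκ_le : ∀ a, κ a Set.univ ≤ 1) {F : α → β → ℝ≥0∞} (hF : Measurable (Function.uncurry F)) :
    Measurable fun a => ∫⁻ b, F a b ∂κ a := by
  let K : Kernel α β := ⟨κ, hκ⟩
  have : IsFiniteKernel K := ⟨1, ENNReal.one_lt_top, hκ_le⟩
  exact hF.lintegral_kernel_prod_right (κ := K)

lemma lintegral_bind_of_measurable {κ : Measure β} {η : β → Measure γ} (hη : Measurable η)
    {F : γ → ℝ≥0∞} (hF : Measurable F) :
    ∫⁻ c, F c ∂κ.bind η = ∫⁻ b, ∫⁻ c, F c ∂η b ∂κ :=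
  Measure.lintegral_bind hη.aemeasurable hF.aemeasurable

lemma measurable_bind_of_subprobability {κ : α → Measure β} (hκ : Measurable κ)
    (hκ_le : ∀ a, κ a Set.univ ≤ 1) {η : α → β → Measure γ}
    (hη : Measurable (Function.uncurry η)) : Measurable fun a => (κ a).bind (η a) := by
  refine measurable_measure_of_lintegral fun F hF => ?_
  simp_rw [fun a => lintegral_bind_of_measurable (κ := κ a) (η := η a)
    (hη.comp measurable_prodMk_left) hF]
  exact measurable_lintegral_of_subprobability hκ hκ_le
    (F := fun a b => ∫⁻ c, F c ∂Function.uncurry η (a, b))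
    ((Measure.measurable_lintegral hF).comp hη)

lemma bind_univ_le_one {κ : Measure β} {η : β → Measure γ} (hη : Measurable η)
    (hκ : κ Set.univ ≤ 1) (hη_le : ∀ b, η b Set.univ ≤ 1) : κ.bind η Set.univ ≤ 1 := by
  rw [Measure.bind_apply MeasurableSet.univ hη.aemeasurable]
  calc ∫⁻ b, η b Set.univ ∂κ ≤ ∫⁻ _, 1 ∂κ := lintegral_mono hη_le
    _ ≤ 1 := by simpa using hκ

end Parametrised

/-! ### Normalised weights and index laws. -/

section Weights

variable {N : ℕ}

lemma measurable_normalise (n : Fin (N + 1)) :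
    Measurable fun w : Fin (N + 1) → ℝ≥0∞ => normalise w n := by
  unfold normalise
  fun_prop

/-- Needs no condition on `w`: if the total weight is `0` or `∞`, division in `ℝ≥0∞` makes the sum
`0`. -/
lemma sum_normalise_le_one (w : Fin (N + 1) → ℝ≥0∞) : ∑ n, normalise w n ≤ 1 := by
  simp only [normalise, ENNReal.div_eq_inv_mul, ← Finset.mul_sum]
  exact ENNReal.inv_mul_le_one _

lemma sum_weights_ne_zero {w : Fin (N + 1) → ℝ≥0∞} (h0 : ∀ n, w n ≠ 0) : ∑ n, w n ≠ 0 := fun h =>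
  h0 0 (Finset.sum_eq_zero_iff.mp h 0 (Finset.mem_univ _))

lemma sum_weights_ne_top {w : Fin (N + 1) → ℝ≥0∞} (ht : ∀ n, w n ≠ ∞) : ∑ n, w n ≠ ∞ :=
  ENNReal.sum_ne_top.mpr fun n _ => ht n

lemma sum_normalise {w : Fin (N + 1) → ℝ≥0∞} (h0 : ∀ n, w n ≠ 0) (ht : ∀ n, w n ≠ ∞) :
    ∑ n, normalise w n = 1 := by
  simp only [normalise, ENNReal.div_eq_inv_mul, ← Finset.mul_sum]
  exact ENNReal.inv_mul_cancel (sum_weights_ne_zero h0) (sum_weights_ne_top ht)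

lemma sum_mul_normalise {w : Fin (N + 1) → ℝ≥0∞} (h0 : ∀ n, w n ≠ 0) (ht : ∀ n, w n ≠ ∞)
    (n : Fin (N + 1)) : (∑ m, w m) * normalise w n = w n :=
  ENNReal.mul_div_cancel (sum_weights_ne_zero h0) (sum_weights_ne_top ht)

lemma normalise_ne_zero {w : Fin (N + 1) → ℝ≥0∞} (h0 : ∀ n, w n ≠ 0) (ht : ∀ n, w n ≠ ∞)
    (n : Fin (N + 1)) : normalise w n ≠ 0 :=
  ENNReal.div_ne_zero.mpr ⟨h0 n, sum_weights_ne_top ht⟩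

lemma normalise_ne_top {w : Fin (N + 1) → ℝ≥0∞} (h0 : ∀ n, w n ≠ 0) (ht : ∀ n, w n ≠ ∞)
    (n : Fin (N + 1)) : normalise w n ≠ ∞ :=
  ENNReal.div_ne_top (ht n) (sum_weights_ne_zero h0)

lemma lintegral_categorical (w : Fin (N + 1) → ℝ≥0∞) (F : Fin (N + 1) → ℝ≥0∞) :
    ∫⁻ i, F i ∂categorical w = ∑ i, normalise w i * F i := by
  simp [categorical]

lemma lintegral_uniformIndex (F : Fin (N + 1) → ℝ≥0∞) :
    ∫⁻ i, F i ∂uniformIndex N = ∑ i, ((N : ℝ≥0∞) + 1)⁻¹ * F i := by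
  simp [uniformIndex]

lemma sum_uniformIndex (N : ℕ) : ∑ _i : Fin (N + 1), ((N : ℝ≥0∞) + 1)⁻¹ = 1 := by
  rw [Finset.sum_const, Finset.card_univ, Fintype.card_fin, nsmul_eq_mul]
  push_cast
  exact ENNReal.mul_inv_cancel (by positivity) (by finiteness)

end Weights

/-! ### One generation: ancestors, parents, particles. -/

section Generations

variable {D N : ℕ} {M : Model D} {t : ℕ}

lemma measurable_weight (n : Fin (N + 1)) :
    Measurable fun g : Generation D N => g.weight n :=
  (measurable_normalise n).comp (measurable_snd.comp measurable_snd)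

lemma measurable_refIndex : Measurable fun g : Generation D N => g.refIndex := measurable_fst

lemma measurable_particle : Measurable fun g : Generation D N => g.particle :=
  measurable_fst.comp measurable_snd

lemma measurable_particle_apply {α : Type*} [MeasurableSpace α] {g : α → Generation D N}
    (hg : Measurable g) (n : Fin (N + 1)) : Measurable fun a => (g a).particle n :=
  (measurable_pi_apply n).comp (measurable_particle.comp hg)

/-- The probability of the ancestor indices `a`. -/
noncomputable def ancestorProb (g : Generation D N) (k : Fin (N + 1))
    (a : Fin (N + 1) → Fin (N + 1)) : ℝ≥0∞ :=
  (if a k = g.refIndex then 1 else 0) * ∏ n ∈ Finset.univ.erase k, g.weight (a n)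

lemma measurable_ancestorProb (k : Fin (N + 1)) (a : Fin (N + 1) → Fin (N + 1)) :
    Measurable fun g : Generation D N => ancestorProb g k a := by
  refine Measurable.mul (Measurable.ite ?_ measurable_const measurable_const)
    (Finset.measurable_prod _ fun n _ => measurable_weight _)
  exact measurable_refIndex (measurableSet_singleton (a k)) |>.congr (by ext; simp [eq_comm])

lemma lintegral_ancestorLaw (g : Generation D N) (k : Fin (N + 1))
    (F : (Fin (N + 1) → Fin (N + 1)) → ℝ≥0∞) :
    ∫⁻ a, F a ∂ancestorLaw g k = ∑ a, ancestorProb g k a * F a := by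
  rw [ancestorLaw, lintegral_finsetSum_measure]
  exact Finset.sum_congr rfl fun a _ => by
    rw [lintegral_smul_measure, lintegral_dirac, smul_eq_mul, ancestorProb]

/-- The probability is a product over `n`, with a point mass as its `k`-th factor, so the sum over
all `a` distributes into a product of sums. -/
lemma sum_ancestorProb (g : Generation D N) (k : Fin (N + 1)) :
    ∑ a, ancestorProb g k a = ∏ _n ∈ Finset.univ.erase k, ∑ j, g.weight j := by
  let f : Fin (N + 1) → Fin (N + 1) → ℝ≥0∞ := fun n j =>
    if n = k then (if j = g.refIndex then 1 else 0) else g.weight j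
  have h : ∀ a, ancestorProb g k a = ∏ n, f n (a n) := by
    intro a
    rw [← Finset.mul_prod_erase _ _ (Finset.mem_univ k), ancestorProb]
    congr 1
    · simp [f]
    · exact Finset.prod_congr rfl fun n hn => by simp [f, Finset.ne_of_mem_erase hn]
  simp_rw [h]
  rw [← Fintype.piFinset_univ, ← Finset.prod_univ_sum,
    ← Finset.mul_prod_erase _ _ (Finset.mem_univ k)]
  have hk : ∑ j, f k j = 1 := by simp [f]
  rw [hk, one_mul]
  exact Finset.prod_congr rfl fun n hn => by simp [f, Finset.ne_of_mem_erase hn]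

lemma sum_weight_le_one (g : Generation D N) : ∑ n, g.weight n ≤ 1 := sum_normalise_le_one _

lemma sum_ancestorProb_le_one (g : Generation D N) (k : Fin (N + 1)) :
    ∑ a, ancestorProb g k a ≤ 1 := by
  rw [sum_ancestorProb]
  exact Finset.prod_le_one' fun _ _ => sum_weight_le_one g

lemma lintegral_parentLaw (t : ℕ) (g : Generation D N) (k : Fin (N + 1))
    {F : (Fin (N + 1) → State D) → ℝ≥0∞} (hF : Measurable F) :
    ∫⁻ y, F y ∂parentLaw t g k =
      if 1 < t then ∑ a, ancestorProb g k a * F (fun n => g.particle (a n)) else F fun _ => 0 := by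
  unfold parentLaw
  split_ifs
  · rw [lintegral_map hF Measurable.of_discrete, lintegral_ancestorLaw]
  · rw [lintegral_dirac' _ hF]

lemma parentLaw_univ_le_one (t : ℕ) (g : Generation D N) (k : Fin (N + 1)) :
    parentLaw t g k Set.univ ≤ 1 := by
  rw [← lintegral_one, lintegral_parentLaw t g k measurable_const]
  split_ifs
  · simpa using sum_ancestorProb_le_one g k
  · exact le_rfl

lemma measurable_parentLaw (t : ℕ) (k : Fin (N + 1)) :
    Measurable fun g : Generation D N => parentLaw t g k := by
  refine measurable_measure_of_lintegral fun F hF => ?_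
  simp_rw [fun g => lintegral_parentLaw t g k hF]
  split_ifs
  · refine Finset.measurable_fun_sum _ fun a _ => (measurable_ancestorProb k a).mul ?_
    exact hF.comp (measurable_pi_lambda _ fun n => measurable_particle_apply measurable_id _)
  · exact measurable_const

lemma Model.Regular.lintegral_particleLaw (hM : M.Regular t) (k : Fin (N + 1))
    (y : Fin (N + 1) → State D) (x : State D) {F : (Fin (N + 1) → State D) → ℝ≥0∞}
    (hF : Measurable F) :
    ∫⁻ z, F z ∂particleLaw M t k y x =
      ∫⁻ z, proposalDensity M t k y (k.insertNth (α := fun _ => State D) x z) *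
        F (k.insertNth (α := fun _ => State D) x z) := by
  have hi : Measurable fun z : Fin N → State D => k.insertNth (α := fun _ => State D) x z :=
    (measurable_insertNth k).comp measurable_prodMk_left
  rw [particleLaw, lintegral_map hF hi]
  exact lintegral_withDensity_eq_lintegral_mul _
    (hM.measurable_proposalDensity_comp k measurable_const hi) (hF.comp hi)

/-- The law of the particles and weights at time `t`, given `k_t = k` and the parents `y`. -/
noncomputable def generationLawOfParents (M : Model D) (t : ℕ) (k : Fin (N + 1))
    (y : Fin (N + 1) → State D) (x : State D) : Measure (Generation D N) :=
  (particleLaw M t k y x).map fun z => ((k, z, unnormalisedWeight M t y z) : Generation D N)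

lemma Model.Regular.lintegral_generationLawOfParents (hM : M.Regular t) (k : Fin (N + 1))
    (y : Fin (N + 1) → State D) (x : State D) {F : Generation D N → ℝ≥0∞} (hF : Measurable F) :
    ∫⁻ h, F h ∂generationLawOfParents M t k y x =
      ∫⁻ z, proposalDensity M t k y (k.insertNth (α := fun _ => State D) x z) *
        F (k, k.insertNth (α := fun _ => State D) x z,
          unnormalisedWeight M t y (k.insertNth (α := fun _ => State D) x z)) := by
  have hg : Measurable fun z => ((k, z, unnormalisedWeight M t y z) : Generation D N) :=
    measurable_const.prodMk (measurable_id.prodMk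
      (hM.measurable_unnormalisedWeight_comp measurable_const measurable_id))
  rw [generationLawOfParents, lintegral_map hF hg]
  exact hM.lintegral_particleLaw k y x (hF.comp hg)

lemma Model.Regular.generationLawOfParents_univ (hM : M.Regular t) (k : Fin (N + 1))
    (y : Fin (N + 1) → State D) (x : State D) :
    generationLawOfParents M t k y x Set.univ = 1 := by
  rw [← lintegral_one, hM.lintegral_generationLawOfParents k y x measurable_const]
  simpa using hM.lintegral_proposalDensity k y x

lemma Model.Regular.measurable_generationLawOfParents (hM : M.Regular t) (k : Fin (N + 1)) :
    Measurable fun p : State D × (Fin (N + 1) → State D) =>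
      generationLawOfParents M t k p.2 p.1 := by
  refine measurable_measure_of_lintegral fun F hF => ?_
  simp_rw [fun y x => hM.lintegral_generationLawOfParents k y x hF]
  have hi : Measurable fun p : (State D × (Fin (N + 1) → State D)) × (Fin N → State D) =>
      k.insertNth (α := fun _ => State D) p.1.1 p.2 :=
    (measurable_insertNth k).comp ((measurable_fst.comp measurable_fst).prodMk measurable_snd)
  have hy : Measurable fun p : (State D × (Fin (N + 1) → State D)) × (Fin N → State D) => p.1.2 :=
    measurable_snd.comp measurable_fst
  exact Measurable.lintegral_prod_right'
    (f := fun p : (State D × (Fin (N + 1) → State D)) × (Fin N → State D) =>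
      proposalDensity M t k p.1.2 (k.insertNth (α := fun _ => State D) p.1.1 p.2) *
        F (k, k.insertNth (α := fun _ => State D) p.1.1 p.2,
          unnormalisedWeight M t p.1.2 (k.insertNth (α := fun _ => State D) p.1.1 p.2)))
    ((hM.measurable_proposalDensity_comp k hy hi).mul (hF.comp (measurable_const.prodMk
      (hi.prodMk (hM.measurable_unnormalisedWeight_comp hy hi)))))

/-- The law of the generation at time `t`, given `k_t = k`. -/
noncomputable def generationLawOfRefIndex (M : Model D) (t : ℕ) (g : Generation D N) (x : State D)
    (k : Fin (N + 1)) : Measure (Generation D N) :=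
  (parentLaw t g k).bind fun y => generationLawOfParents M t k y x

lemma generationLaw_eq (M : Model D) (t : ℕ) (g : Generation D N) (x : State D) :
    generationLaw M t g x = (uniformIndex N).bind (generationLawOfRefIndex M t g x) := rfl

lemma Model.Regular.measurable_generationLawOfRefIndex (hM : M.Regular t) (k : Fin (N + 1)) :
    Measurable fun p : Generation D N × State D => generationLawOfRefIndex M t p.1 p.2 k :=
  measurable_bind_of_subprobability ((measurable_parentLaw t k).comp measurable_fst)
    (fun _ => parentLaw_univ_le_one _ _ _)
    ((hM.measurable_generationLawOfParents k).comp
      ((measurable_snd.comp measurable_fst).prodMk measurable_snd))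

lemma Model.Regular.lintegral_generationLaw (hM : M.Regular t) (g : Generation D N) (x : State D)
    {F : Generation D N → ℝ≥0∞} (hF : Measurable F) :
    ∫⁻ h, F h ∂generationLaw M t g x =
      ∑ k, ((N : ℝ≥0∞) + 1)⁻¹ *
        ∫⁻ y, ∫⁻ h, F h ∂generationLawOfParents M t k y x ∂parentLaw t g k := by
  rw [generationLaw_eq, lintegral_bind_of_measurable Measurable.of_discrete hF,
    lintegral_uniformIndex]
  refine Finset.sum_congr rfl fun k _ => ?_
  rw [generationLawOfRefIndex, lintegral_bind_of_measurable (η := fun y => generationLawOfParents M t k y x)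
    ((hM.measurable_generationLawOfParents k).comp measurable_prodMk_left) hF]

lemma Model.Regular.measurable_generationLaw (hM : M.Regular t) :
    Measurable fun p : Generation D N × State D => generationLaw M t p.1 p.2 := by
  refine measurable_measure_of_lintegral fun F hF => ?_
  simp_rw [fun g x => generationLaw_eq M t (N := N) g x,
    fun g x => lintegral_bind_of_measurable (κ := uniformIndex N)
      (η := generationLawOfRefIndex M t g x) Measurable.of_discrete hF, lintegral_uniformIndex]
  exact Finset.measurable_fun_sum _ fun k _ => measurable_const.mul
    ((Measure.measurable_lintegral hF).comp (hM.measurable_generationLawOfRefIndex k))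

lemma Model.Regular.generationLaw_univ_le_one (hM : M.Regular t) (g : Generation D N)
    (x : State D) : generationLaw M t g x Set.univ ≤ 1 := by
  rw [← lintegral_one, hM.lintegral_generationLaw g x measurable_const]
  simp only [lintegral_one, hM.generationLawOfParents_univ]
  calc _ ≤ ∑ _k : Fin (N + 1), ((N : ℝ≥0∞) + 1)⁻¹ * 1 := by
        gcongr
        exact parentLaw_univ_le_one _ _ _
    _ = 1 := by simpa only [mul_one] using sum_uniformIndex N

end Generations

/-! ### Reversibility of the forced move. -/

section ForcedMove

variable {N : ℕ} {W : Fin (N + 1) → ℝ≥0∞}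

lemma lintegral_forcedMove (W : Fin (N + 1) → ℝ≥0∞) (k : Fin (N + 1))
    (F : Fin (N + 1) → ℝ≥0∞) :
    ∫⁻ i, F i ∂forcedMove W k = ∑ i ∈ Finset.univ.erase k, W i / (1 - W k) *
      (min 1 ((1 - W k) / (1 - W i)) * F i + (1 - min 1 ((1 - W k) / (1 - W i))) * F k) := by
  rw [forcedMove, lintegral_finsetSum_measure]
  refine Finset.sum_congr rfl fun i _ => ?_
  simp only [lintegral_smul_measure, lintegral_add_measure, lintegral_dirac, smul_eq_mul]

lemma forcedMove_univ (W : Fin (N + 1) → ℝ≥0∞) (k : Fin (N + 1)) :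
    forcedMove W k Set.univ = (∑ i ∈ Finset.univ.erase k, W i) / (1 - W k) := by
  rw [← lintegral_one, lintegral_forcedMove, ENNReal.div_eq_inv_mul, Finset.mul_sum]
  refine Finset.sum_congr rfl fun i _ => ?_
  rw [mul_one, mul_one, add_tsub_cancel_of_le (min_le_left _ _), mul_one, ENNReal.div_eq_inv_mul]

lemma sum_erase_le_one_sub (hW : ∑ n, W n ≤ 1) (k : Fin (N + 1)) :
    ∑ i ∈ Finset.univ.erase k, W i ≤ 1 - W k := by
  have h := hW
  rw [← Finset.add_sum_erase _ _ (Finset.mem_univ k)] at h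
  refine ENNReal.le_sub_of_add_le_left ?_ h
  exact ne_top_of_le_ne_top ENNReal.one_ne_top (le_self_add.trans h)

lemma one_sub_eq_sum_erase (hW : ∑ n, W n = 1) (k : Fin (N + 1)) :
    1 - W k = ∑ i ∈ Finset.univ.erase k, W i := by
  refine le_antisymm ?_ (sum_erase_le_one_sub hW.le k)
  rw [← hW, ← Finset.add_sum_erase _ _ (Finset.mem_univ k)]
  exact tsub_le_iff_left.mpr le_rfl

lemma forcedMove_univ_le_one (hW : ∑ n, W n ≤ 1) (k : Fin (N + 1)) :
    forcedMove W k Set.univ ≤ 1 := by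
  rw [forcedMove_univ]
  exact ENNReal.div_le_of_le_mul (by simpa using sum_erase_le_one_sub hW k)

/-- With `N ≥ 1` there is a second index, and it has positive weight. -/
lemma one_sub_weight_ne_zero (hN : 1 ≤ N) (hW0 : ∀ n, W n ≠ 0) (hW : ∑ n, W n = 1)
    (k : Fin (N + 1)) : 1 - W k ≠ 0 := by
  have : NeZero N := ⟨by omega⟩
  obtain ⟨i, hi⟩ := exists_ne k
  rw [one_sub_eq_sum_erase hW]
  exact fun h => hW0 i (Finset.sum_eq_zero_iff.mp h i (by simpa using hi))

lemma one_sub_weight_ne_top (k : Fin (N + 1)) : 1 - W k ≠ ∞ :=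
  ne_top_of_le_ne_top ENNReal.one_ne_top tsub_le_self

lemma sum_erase_div (hN : 1 ≤ N) (hW0 : ∀ n, W n ≠ 0) (hW : ∑ n, W n = 1) (k : Fin (N + 1)) :
    (∑ i ∈ Finset.univ.erase k, W i) / (1 - W k) = 1 := by
  rw [← one_sub_eq_sum_erase hW]
  exact ENNReal.div_self (one_sub_weight_ne_zero hN hW0 hW k) (one_sub_weight_ne_top k)

lemma inv_mul_min_one_div {a b : ℝ≥0∞} (ha : a ≠ 0) (ha' : a ≠ ∞) :
    a⁻¹ * min 1 (a / b) = min a⁻¹ b⁻¹ := by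
  rw [mul_min, mul_one, ENNReal.div_eq_inv_mul, mul_comm b⁻¹, ← mul_assoc,
    ENNReal.inv_mul_cancel ha ha', one_mul]

/-- Detailed balance: the accepted flow from `k` to `i` is `W k * W i * min (1 - W k)⁻¹ (1 - W
i)⁻¹`, symmetric in `k` and `i`. -/
lemma sum_forcedMove (hN : 1 ≤ N) (hW0 : ∀ n, W n ≠ 0) (hW : ∑ n, W n = 1)
    (F : Fin (N + 1) → ℝ≥0∞) :
    ∑ k, W k * ∫⁻ i, F i ∂forcedMove W k = ∑ k, W k * F k := by
  let m : Fin (N + 1) → Fin (N + 1) → ℝ≥0∞ := fun k i => min 1 ((1 - W k) / (1 - W i))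
  have hs : ∀ k i, W k * (W i / (1 - W k)) * m k i = W i * (W k / (1 - W i)) * m i k := by
    intro k i
    have h : ∀ k i, W k * (W i / (1 - W k)) * m k i =
        W k * W i * min (1 - W k)⁻¹ (1 - W i)⁻¹ := by
      intro k i
      rw [← inv_mul_min_one_div (one_sub_weight_ne_zero hN hW0 hW k) (one_sub_weight_ne_top k),
        ENNReal.div_eq_inv_mul]
      ring
    rw [h, h, min_comm, mul_comm (W k)]
  have hswap : ∑ k, ∑ i ∈ Finset.univ.erase k, W k * (W i / (1 - W k)) * m k i * F i =
      ∑ k, ∑ i ∈ Finset.univ.erase k, W k * (W i / (1 - W k)) * m k i * F k := by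
    rw [Finset.sum_comm' (t' := Finset.univ) (s' := fun i => Finset.univ.erase i)
      (by simp [eq_comm])]
    exact Finset.sum_congr rfl fun i _ => Finset.sum_congr rfl fun k _ => by rw [hs]
  calc ∑ k, W k * ∫⁻ i, F i ∂forcedMove W k
      = ∑ k, ∑ i ∈ Finset.univ.erase k, W k * (W i / (1 - W k)) * m k i * F i +
        ∑ k, ∑ i ∈ Finset.univ.erase k, W k * (W i / (1 - W k)) * (1 - m k i) * F k := by
        rw [← Finset.sum_add_distrib]
        refine Finset.sum_congr rfl fun k _ => ?_
        rw [lintegral_forcedMove, Finset.mul_sum, ← Finset.sum_add_distrib]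
        exact Finset.sum_congr rfl fun i _ => by ring
    -- After the swap, accepted and rejected moves carry the same `F k`, so the acceptance
    -- probabilities add up to one and only the mass of the proposal remains.
    _ = ∑ k, W k * F k * ((∑ i ∈ Finset.univ.erase k, W i) / (1 - W k)) := by
        rw [hswap, ← Finset.sum_add_distrib]
        refine Finset.sum_congr rfl fun k _ => ?_
        rw [← Finset.sum_add_distrib, ENNReal.div_eq_inv_mul, Finset.mul_sum, Finset.mul_sum]
        refine Finset.sum_congr rfl fun i _ => ?_
        rw [← add_mul, ← mul_add, add_tsub_cancel_of_le (min_le_left _ _), ENNReal.div_eq_inv_mul]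
        ring
    _ = ∑ k, W k * F k := by simp only [sum_erase_div hN hW0 hW, mul_one]

end ForcedMove

/-! ### Selection of the output path; measurability of the algorithm. -/

section Selection

variable {D N : ℕ} {M : Model D} {t : ℕ}

/-- The weights of a generation are positive and finite. -/
def Generation.Nondegenerate (g : Generation D N) : Prop := ∀ n, g.2.2 n ≠ 0 ∧ g.2.2 n ≠ ∞

lemma Generation.Nondegenerate.sum_weight {g : Generation D N} (hg : g.Nondegenerate) :
    ∑ n, g.weight n = 1 :=
  sum_normalise (fun n => (hg n).1) fun n => (hg n).2

lemma Generation.Nondegenerate.weight_ne_zero {g : Generation D N} (hg : g.Nondegenerate)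
    (n : Fin (N + 1)) : g.weight n ≠ 0 :=
  normalise_ne_zero (fun n => (hg n).1) (fun n => (hg n).2) n

lemma Generation.Nondegenerate.weight_ne_top {g : Generation D N} (hg : g.Nondegenerate)
    (n : Fin (N + 1)) : g.weight n ≠ ∞ :=
  normalise_ne_top (fun n => (hg n).1) (fun n => (hg n).2) n

/-- The law of the returned states at time `t = T`, given the generation at that time. -/
noncomputable def finalLaw (h : Generation D N) : Measure (Fin 1 → State D) :=
  (forcedMove h.weight h.refIndex).map fun l => fun _ => h.particle l

lemma lintegral_finalLaw (h : Generation D N) {F : (Fin 1 → State D) → ℝ≥0∞}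
    (hF : Measurable F) :
    ∫⁻ x, F x ∂finalLaw h =
      ∫⁻ l, F (fun _ => h.particle l) ∂forcedMove h.weight h.refIndex := by
  rw [finalLaw, lintegral_map hF Measurable.of_discrete]

lemma measurable_finalLaw : Measurable fun h : Generation D N => finalLaw h := by
  refine measurable_measure_of_lintegral fun F hF => ?_
  simp_rw [fun h : Generation D N => lintegral_finalLaw h hF, lintegral_forcedMove]
  -- The range of the sum depends on the reference index; as that index is discrete, it can be
  -- fixed.
  refine measurable_from_prod_countable_right fun k => ?_
  have hw : ∀ n, Measurable fun b : (Fin (N + 1) → State D) × (Fin (N + 1) → ℝ≥0∞) =>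
      Generation.weight ((k, b) : Generation D N) n := fun n =>
    (measurable_weight n).comp measurable_prodMk_left
  have hp : ∀ n, Measurable fun b : (Fin (N + 1) → State D) × (Fin (N + 1) → ℝ≥0∞) =>
      F fun _ => Generation.particle ((k, b) : Generation D N) n := fun n =>
    hF.comp (measurable_pi_lambda _ fun _ => measurable_particle_apply measurable_prodMk_left n)
  change Measurable fun b : (Fin (N + 1) → State D) × (Fin (N + 1) → ℝ≥0∞) =>
    ∑ i ∈ Finset.univ.erase k, _
  refine Finset.measurable_fun_sum _ fun i _ => ?_
  have h1 := hw i
  have h2 := hw k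
  have h3 := hp i
  have h4 := hp k
  have hm : Measurable fun b : (Fin (N + 1) → State D) × (Fin (N + 1) → ℝ≥0∞) =>
      min 1 ((1 - Generation.weight ((k, b) : Generation D N) k) /
        (1 - Generation.weight ((k, b) : Generation D N) i)) :=
    measurable_const.min ((measurable_const.sub h2).div (measurable_const.sub h1))
  exact (h1.div (measurable_const.sub h2)).mul ((hm.mul h3).add ((measurable_const.sub hm).mul h4))

lemma finalLaw_univ (h : Generation D N) :
    finalLaw h Set.univ = forcedMove h.weight h.refIndex Set.univ := by
  rw [← lintegral_one, lintegral_finalLaw h measurable_const, lintegral_one]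

/-- The law of the returned states from time `t` on, given the generation at time `t < T` and the
returned states after time `t`. -/
noncomputable def backwardStep (M : Model D) (t : ℕ) {r : ℕ} (h : Generation D N)
    (x' : Fin (r + 1) → State D) : Measure (Fin (r + 2) → State D) :=
  (backwardLaw M t h (x' 0)).map fun l => (Fin.cons (h.particle l) x' : Fin (r + 2) → State D)

/-- The probability that backward sampling selects the index `l`. -/
noncomputable def backwardProb (M : Model D) (t : ℕ) (h : Generation D N) (y : State D)
    (l : Fin (N + 1)) : ℝ≥0∞ :=
  normalise (fun i => h.weight i * ENNReal.ofReal (M.Q (t + 1) (h.particle i) y)) l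

lemma lintegral_backwardStep (M : Model D) (t : ℕ) {r : ℕ} (h : Generation D N)
    (x' : Fin (r + 1) → State D) {F : (Fin (r + 2) → State D) → ℝ≥0∞} (hF : Measurable F) :
    ∫⁻ x, F x ∂backwardStep M t h x' = ∑ l, backwardProb M t h (x' 0) l *
      F (Fin.cons (h.particle l) x' : Fin (r + 2) → State D) := by
  rw [backwardStep, lintegral_map hF Measurable.of_discrete, backwardLaw, lintegral_categorical]
  rfl

lemma backwardStep_univ (M : Model D) (t : ℕ) {r : ℕ} (h : Generation D N)
    (x' : Fin (r + 1) → State D) :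
    backwardStep M t h x' Set.univ = ∑ l, backwardProb M t h (x' 0) l := by
  rw [← lintegral_one, lintegral_backwardStep M t h x' measurable_const]
  simp

lemma backwardStep_univ_le_one (M : Model D) (t : ℕ) {r : ℕ} (h : Generation D N)
    (x' : Fin (r + 1) → State D) : backwardStep M t h x' Set.univ ≤ 1 := by
  rw [backwardStep_univ]
  exact sum_normalise_le_one _

lemma Model.Regular.measurable_backwardStep (hM : M.Regular (t + 1)) {r : ℕ} :
    Measurable fun p : Generation D N × (Fin (r + 1) → State D) => backwardStep M t p.1 p.2 := by
  refine measurable_measure_of_lintegral fun F hF => ?_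
  simp_rw [fun (h : Generation D N) (x' : Fin (r + 1) → State D) =>
    lintegral_backwardStep M t h x' hF]
  refine Finset.measurable_fun_sum _ fun l _ => Measurable.mul ?_ ?_
  · refine (measurable_normalise l).comp (measurable_pi_lambda _ fun i => ?_)
    exact ((measurable_weight i).comp measurable_fst).mul (hM.measurable_Q_comp
      (measurable_particle_apply measurable_fst i)
      ((measurable_pi_apply 0).comp measurable_snd))
  · exact hF.comp (measurable_cons.comp
      ((measurable_particle_apply measurable_fst l).prodMk measurable_snd))

lemma Model.Regular.backwardWeight_ne_zero (hM : M.Regular (t + 1)) {h : Generation D N}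
    (hh : h.Nondegenerate) (y : State D) (i : Fin (N + 1)) :
    h.weight i * ENNReal.ofReal (M.Q (t + 1) (h.particle i) y) ≠ 0 :=
  mul_ne_zero (hh.weight_ne_zero i) (ENNReal.ofReal_pos.mpr (hM.Q_pos _ _)).ne'

lemma backwardWeight_ne_top (M : Model D) (t : ℕ) {h : Generation D N} (hh : h.Nondegenerate)
    (y : State D) (i : Fin (N + 1)) :
    h.weight i * ENNReal.ofReal (M.Q (t + 1) (h.particle i) y) ≠ ∞ :=
  ENNReal.mul_ne_top (hh.weight_ne_top i) ENNReal.ofReal_ne_top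

/-- The law of the returned states `x'_t, …, x'_{t+r}`, where `T = t + r`, given the generation at
time `t` and the reference states after time `t`. -/
noncomputable def selectFrom (M : Model D) : (r t : ℕ) → Generation D N → (Fin r → State D) →
    Measure (Fin (r + 1) → State D)
  | 0, _, h, _ => finalLaw h
  | r + 1, t, h, x => (runFrom M (r + 1) (t + 1) h x).bind (backwardStep M t h)

/-- Merges the final step and the earlier steps into one recursion, so that every induction below
has a single step; the distinction moves into `selectFrom`. -/
lemma runFrom_succ (M : Model D) (r t : ℕ) (g : Generation D N) (x : Fin (r + 1) → State D) :
    runFrom M (r + 1) t g x =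
      (generationLaw M t g (x 0)).bind fun h => selectFrom M r t h (Fin.tail x) := by
  cases r <;> rfl

variable {r : ℕ}

lemma measurable_tail : Measurable fun x : Fin (r + 1) → State D => (Fin.tail x : Fin r → State D) :=
  measurable_pi_lambda _ fun i => measurable_pi_apply i.succ

lemma measurable_selectFrom (hM : ∀ s, t ≤ s → s < t + (r + 1) → M.Regular s)
    (ih : Measurable fun p : Generation D N × (Fin r → State D) => runFrom M r (t + 1) p.1 p.2)
    (ih_le : ∀ (g : Generation D N) x, runFrom M r (t + 1) g x Set.univ ≤ 1) :
    Measurable fun p : Generation D N × (Fin r → State D) => selectFrom M r t p.1 p.2 := by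
  cases r with
  | zero => exact measurable_finalLaw.comp measurable_fst
  | succ r =>
    exact measurable_bind_of_subprobability ih (fun p => ih_le p.1 p.2)
      ((hM (t + 1) (by omega) (by omega)).measurable_backwardStep.comp
        ((measurable_fst.comp measurable_fst).prodMk measurable_snd))

lemma selectFrom_univ_le_one (hM : ∀ s, t ≤ s → s < t + (r + 1) → M.Regular s)
    (ih_le : ∀ (g : Generation D N) x, runFrom M r (t + 1) g x Set.univ ≤ 1)
    (h : Generation D N) (x : Fin r → State D) : selectFrom M r t h x Set.univ ≤ 1 := by
  cases r with
  | zero => exact (finalLaw_univ h).trans_le (forcedMove_univ_le_one (sum_weight_le_one h) _)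
  | succ r =>
    exact bind_univ_le_one ((hM (t + 1) (by omega) (by omega)).measurable_backwardStep.comp
      measurable_prodMk_left) (ih_le h x) (backwardStep_univ_le_one M t h)

/-- The two claims need a joint induction: measurability of a composition uses the mass bound, and
the mass bound uses measurability. -/
lemma measurable_runFrom_and_le_one : ∀ {r t : ℕ}
    (_ : ∀ s, t ≤ s → s < t + r → M.Regular s),
    (Measurable fun p : Generation D N × (Fin r → State D) => runFrom M r t p.1 p.2) ∧
      ∀ (g : Generation D N) (x : Fin r → State D), runFrom M r t g x Set.univ ≤ 1
  | 0, t, _ => by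
    simp only [runFrom]
    exact ⟨measurable_const, fun _ _ => prob_le_one⟩
  | r + 1, t, hM => by
    have hMt := hM t le_rfl (by omega)
    obtain ⟨ih, ih_le⟩ := measurable_runFrom_and_le_one (r := r) (t := t + 1)
      fun s hs hs' => hM s (by omega) (by omega)
    have hsel := measurable_selectFrom hM ih ih_le
    simp only [runFrom_succ]
    constructor
    · have hgen : Measurable fun p : Generation D N × (Fin (r + 1) → State D) =>
          generationLaw M t p.1 (p.2 0) :=
        hMt.measurable_generationLaw.comp
          (f := fun p : Generation D N × (Fin (r + 1) → State D) => (p.1, p.2 0))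
          (measurable_fst.prodMk (by fun_prop))
      have hsel' : Measurable fun q : (Generation D N × (Fin (r + 1) → State D)) ×
          Generation D N => selectFrom M r t q.2 (Fin.tail q.1.2) :=
        hsel.comp (f := fun q : (Generation D N × (Fin (r + 1) → State D)) ×
          Generation D N => (q.2, (Fin.tail q.1.2 : Fin r → State D)))
          (measurable_snd.prodMk (measurable_tail.comp (measurable_snd.comp measurable_fst)))
      exact measurable_bind_of_subprobability hgen
        (fun p => hMt.generationLaw_univ_le_one _ _) hsel'
    · intro g x
      have hsel' : Measurable fun h : Generation D N => selectFrom M r t h (Fin.tail x) :=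
        hsel.comp (f := fun h : Generation D N => (h, (Fin.tail x : Fin r → State D)))
          (measurable_id.prodMk measurable_const)
      exact bind_univ_le_one hsel' (hMt.generationLaw_univ_le_one _ _)
        fun h => selectFrom_univ_le_one hM ih_le h _

lemma measurable_runFrom (hM : ∀ s, t ≤ s → s < t + r → M.Regular s) :
    Measurable fun p : Generation D N × (Fin r → State D) => runFrom M r t p.1 p.2 :=
  (measurable_runFrom_and_le_one hM).1

lemma measurable_selectFrom' (hM : ∀ s, t ≤ s → s < t + (r + 1) → M.Regular s) :
    Measurable fun p : Generation D N × (Fin r → State D) => selectFrom M r t p.1 p.2 := by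
  obtain ⟨h, h_le⟩ := measurable_runFrom_and_le_one (N := N) (r := r) (t := t + 1) (M := M)
    fun s hs hs' => hM s (by omega) (by omega)
  exact measurable_selectFrom hM h h_le

end Selection

lemma sum_mul_lintegral {ι α : Type*} [Fintype ι] [MeasurableSpace α] {μ : Measure α}
    (c : ι → ℝ≥0∞) (f : ι → α → ℝ≥0∞) (hf : ∀ i, Measurable (f i)) :
    ∑ i, c i * ∫⁻ x, f i x ∂μ = ∫⁻ x, ∑ i, c i * f i x ∂μ := by
  rw [lintegral_finsetSum _ fun i _ => (hf i).const_mul (c i)]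
  exact Finset.sum_congr rfl fun i _ => (lintegral_const_mul _ (hf i)).symm

lemma sum_comm_three {ι κ τ : Type*} [Fintype ι] [Fintype κ] [Fintype τ]
    (T : ι → κ → τ → ℝ≥0∞) : ∑ j, ∑ k, ∑ a, T j k a = ∑ a, ∑ k, ∑ j, T j k a := by
  rw [Finset.sum_comm, Finset.sum_congr rfl fun k _ => Finset.sum_comm, Finset.sum_comm]

/-! ### The extended target and the exchange of the reference index. -/

section Exchange

variable {D N : ℕ} {M : Model D} {t : ℕ}

lemma Generation.Nondegenerate.sum_ancestorProb {g : Generation D N} (hg : g.Nondegenerate)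
    (k : Fin (N + 1)) : ∑ a, ancestorProb g k a = 1 := by
  rw [MarginalCSMC.sum_ancestorProb, hg.sum_weight, Finset.prod_const_one]

/-- Puts time `1` on the same footing as later times: if all particles are the dummy `0`, any choice
of ancestors gives the parents `0`. -/
lemma lintegral_parentLaw_eq_sum {g : Generation D N} (hg : g.Nondegenerate)
    (hgt : 1 < t ∨ g.particle = 0) (k : Fin (N + 1)) {F : (Fin (N + 1) → State D) → ℝ≥0∞}
    (hF : Measurable F) :
    ∫⁻ y, F y ∂parentLaw t g k = ∑ a, ancestorProb g k a * F (fun n => g.particle (a n)) := by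
  rw [lintegral_parentLaw t g k hF]
  split_ifs with ht
  · rfl
  · rw [hgt.resolve_left ht]
    simp only [Pi.zero_apply, ← Finset.sum_mul, hg.sum_ancestorProb, one_mul]

lemma Model.Regular.lintegral_generationLaw_eq_sum (hM : M.Regular t) {g : Generation D N}
    (hg : g.Nondegenerate) (hgt : 1 < t ∨ g.particle = 0) (x : State D)
    {F : Generation D N → ℝ≥0∞} (hF : Measurable F) :
    ∫⁻ h, F h ∂generationLaw M t g x = ∑ k, ((N : ℝ≥0∞) + 1)⁻¹ * ∑ a, ancestorProb g k a *
      ∫⁻ h, F h ∂generationLawOfParents M t k (fun n => g.particle (a n)) x := by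
  rw [hM.lintegral_generationLaw g x hF]
  refine Finset.sum_congr rfl fun k _ => ?_
  rw [lintegral_parentLaw_eq_sum hg hgt k (F := fun y =>
    ∫⁻ h, F h ∂generationLawOfParents M t k y x)]
  exact (Measure.measurable_lintegral hF).comp
    ((hM.measurable_generationLawOfParents k).comp measurable_prodMk_left)

lemma Model.Regular.generationLaw_univ (hM : M.Regular t) {g : Generation D N}
    (hg : g.Nondegenerate) (hgt : 1 < t ∨ g.particle = 0) (x : State D) :
    generationLaw M t g x Set.univ = 1 := by
  rw [← lintegral_one, hM.lintegral_generationLaw_eq_sum hg hgt x measurable_const]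
  simp only [lintegral_one, hM.generationLawOfParents_univ, mul_one, hg.sum_ancestorProb,
    sum_uniformIndex]

/-- The weight of the reference index is the missing `k`-th factor of the product over the
ancestors, so the result depends on `k` only through the constraint `a k = j`. -/
lemma weight_mul_ancestorProb (p : Fin (N + 1) → State D) (w : Fin (N + 1) → ℝ≥0∞)
    (j k : Fin (N + 1)) (a : Fin (N + 1) → Fin (N + 1)) :
    normalise w j * ancestorProb ((j, p, w) : Generation D N) k a =
      if a k = j then ∏ n, normalise w (a n) else 0 := by
  unfold ancestorProb
  change normalise w j * ((if a k = j then 1 else 0) *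
    ∏ n ∈ Finset.univ.erase k, normalise w (a n)) = _
  split_ifs with h
  · rw [one_mul, ← h, Finset.mul_prod_erase _ (fun n => normalise w (a n)) (Finset.mem_univ k)]
  · rw [zero_mul, mul_zero]

/-- The particles, weights and reference index at time `t`, given the parents `y`, when the
reference state has the unnormalised density `Q_t(y k, ·)`. -/
lemma Model.Regular.lintegral_Q_mul_generationLawOfParents (hM : M.Regular t) (k : Fin (N + 1))
    (y : Fin (N + 1) → State D) {F : State D → Generation D N → ℝ≥0∞}
    (hF : Measurable (Function.uncurry F)) :
    ∫⁻ x, ENNReal.ofReal (M.Q t (y k) x) * ∫⁻ h, F x h ∂generationLawOfParents M t k y x =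
      ∫⁻ z, unnormalisedWeight M t y z k * F (z k) (k, z, unnormalisedWeight M t y z) := by
  have hg : Measurable fun z => ((k, z, unnormalisedWeight M t y z) : Generation D N) :=
    measurable_const.prodMk (measurable_id.prodMk
      (hM.measurable_unnormalisedWeight_comp measurable_const measurable_id))
  have hw : Measurable fun z => unnormalisedWeight M t y z k :=
    (measurable_pi_apply k).comp
      (hM.measurable_unnormalisedWeight_comp measurable_const measurable_id)
  have hint : Measurable fun z => unnormalisedWeight M t y z k *
      F (z k) (k, z, unnormalisedWeight M t y z) :=
    hw.mul (hF.comp ((measurable_pi_apply k).prodMk hg))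
  -- The reference state becomes the `k`-th coordinate of `z`; then `Q_t` times the proposal density
  -- is by definition the `k`-th weight.
  rw [lintegral_insertNth k hint]
  refine lintegral_congr fun x => ?_
  have hFx : Measurable (F x) := hF.comp measurable_prodMk_left
  rw [hM.lintegral_generationLawOfParents k y x hFx,
    ← lintegral_const_mul' _ _ ENNReal.ofReal_ne_top]
  refine lintegral_congr fun z => ?_
  rw [Fin.insertNth_apply_same, ← mul_assoc, unnormalisedWeight, Fin.insertNth_apply_same]

/-- The extended target: the joint law of the generations at the times `t - 1` and `t`, in which the
reference index at time `t - 1` is drawn according to the weights, and in which the reference state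
at time `t` is drawn from `Q_t`. -/
lemma Model.Regular.sum_lintegral_generationLaw (hM : M.Regular t) {p : Fin (N + 1) → State D}
    {w : Fin (N + 1) → ℝ≥0∞} (hw : ∀ n, w n ≠ 0 ∧ w n ≠ ∞) (ht : 1 < t ∨ p = 0)
    {F : State D → Generation D N → ℝ≥0∞} (hF : Measurable (Function.uncurry F)) :
    ∑ j, normalise w j * ∫⁻ x, ENNReal.ofReal (M.Q t (p j) x) *
        ∫⁻ h, F x h ∂generationLaw M t (j, p, w) x =
      ((N : ℝ≥0∞) + 1)⁻¹ * ∑ a : Fin (N + 1) → Fin (N + 1), (∏ n, normalise w (a n)) *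
        ∫⁻ z, ∑ k, unnormalisedWeight M t (fun n => p (a n)) z k *
          F (z k) (k, z, unnormalisedWeight M t (fun n => p (a n)) z) := by
  have hFx : ∀ x, Measurable (F x) := fun x => hF.comp measurable_prodMk_left
  let J : Fin (N + 1) → Fin (N + 1) → (Fin (N + 1) → Fin (N + 1)) → ℝ≥0∞ := fun j k a =>
    ∫⁻ x, ENNReal.ofReal (M.Q t (p j) x) *
      ∫⁻ h, F x h ∂generationLawOfParents M t k (fun n => p (a n)) x
  have hI : ∀ k (a : Fin (N + 1) → Fin (N + 1)), Measurable fun x =>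
      ∫⁻ h, F x h ∂generationLawOfParents M t k (fun n => p (a n)) x := fun k a =>
    measurable_lintegral_of_subprobability
      ((hM.measurable_generationLawOfParents k).comp measurable_prodMk_right)
      (fun x => (hM.generationLawOfParents_univ k _ x).le) hF
  have hQ : ∀ j, Measurable fun x => ENNReal.ofReal (M.Q t (p j) x) := fun j =>
    hM.measurable_Q_comp measurable_const measurable_id
  have h1 : ∀ j, ∫⁻ x, ENNReal.ofReal (M.Q t (p j) x) *
        ∫⁻ h, F x h ∂generationLaw M t (j, p, w) x =
      ∑ k, ∑ a, ((N : ℝ≥0∞) + 1)⁻¹ * ancestorProb ((j, p, w) : Generation D N) k a * J j k a := by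
    intro j
    have h2 : ∀ x, ENNReal.ofReal (M.Q t (p j) x) *
        ∫⁻ h, F x h ∂generationLaw M t (j, p, w) x =
        ∑ k, ∑ a, ((N : ℝ≥0∞) + 1)⁻¹ * ancestorProb ((j, p, w) : Generation D N) k a *
          (ENNReal.ofReal (M.Q t (p j) x) *
            ∫⁻ h, F x h ∂generationLawOfParents M t k (fun n => p (a n)) x) := by
      intro x
      rw [hM.lintegral_generationLaw_eq_sum (g := (j, p, w)) hw ht x (hFx x), Finset.mul_sum]
      refine Finset.sum_congr rfl fun k _ => ?_
      rw [Finset.mul_sum, Finset.mul_sum]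
      refine Finset.sum_congr rfl fun a _ => ?_
      rw [show (fun n => Generation.particle ((j, p, w) : Generation D N) (a n)) =
        fun n => p (a n) from rfl]
      ring
    have hm : ∀ k (a : Fin (N + 1) → Fin (N + 1)), Measurable fun x =>
        ENNReal.ofReal (M.Q t (p j) x) *
          ∫⁻ h, F x h ∂generationLawOfParents M t k (fun n => p (a n)) x :=
      fun k a => (hQ j).mul (hI k a)
    rw [lintegral_congr h2, lintegral_finsetSum _ fun k _ =>
      Finset.measurable_fun_sum _ fun a _ => (hm k a).const_mul _]
    refine Finset.sum_congr rfl fun k _ => ?_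
    rw [lintegral_finsetSum _ fun a _ => (hm k a).const_mul _]
    exact Finset.sum_congr rfl fun a _ => lintegral_const_mul _ (hm k a)
  simp only [h1, Finset.mul_sum]
  rw [sum_comm_three]
  refine Finset.sum_congr rfl fun a _ => ?_
  rw [lintegral_finsetSum, Finset.mul_sum, Finset.mul_sum]
  · refine Finset.sum_congr rfl fun k _ => ?_
    have h3 : ∀ j, normalise w j * (((N : ℝ≥0∞) + 1)⁻¹ *
        ancestorProb ((j, p, w) : Generation D N) k a * J j k a) =
        if a k = j then ((N : ℝ≥0∞) + 1)⁻¹ * ((∏ n, normalise w (a n)) * J j k a) else 0 := by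
      intro j
      rw [show normalise w j * (((N : ℝ≥0∞) + 1)⁻¹ *
        ancestorProb ((j, p, w) : Generation D N) k a * J j k a) = ((N : ℝ≥0∞) + 1)⁻¹ *
          ((normalise w j * ancestorProb ((j, p, w) : Generation D N) k a) * J j k a) by ring,
        weight_mul_ancestorProb]
      split_ifs <;> simp
    -- Only `j = a k` survives, which makes `p j` the parent of the reference particle.
    simp only [h3, Finset.sum_ite_eq, Finset.mem_univ, if_true]
    rw [← hM.lintegral_Q_mul_generationLawOfParents k (fun n => p (a n)) hF]
  · intro k _
    have hw' := hM.measurable_unnormalisedWeight_comp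
      (f := fun _ : Fin (N + 1) → State D => fun n => p (a n)) measurable_const measurable_id
    exact ((measurable_pi_apply k).comp hw').mul (hF.comp ((measurable_pi_apply k).prodMk
      (measurable_const.prodMk (measurable_id.prodMk hw'))))

end Exchange

/-! ### Invariance of the selection stage. -/

section Invariance

variable {D N : ℕ} {M : Model D}

/-- The unnormalised target density of `x_t, …, x_{t+r-1}`, given `x_{t-1} = y`. -/
noncomputable def tailDensity (M : Model D) : (r t : ℕ) → State D → (Fin r → State D) → ℝ≥0∞
  | 0, _, _, _ => 1
  | r + 1, t, y, x => ENNReal.ofReal (M.Q t y (x 0)) * tailDensity M r (t + 1) (x 0) (Fin.tail x)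

lemma measurable_tailDensity : ∀ {r t : ℕ} (_ : ∀ s, t ≤ s → s < t + r → M.Regular s),
    Measurable fun q : State D × (Fin r → State D) => tailDensity M r t q.1 q.2
  | 0, _, _ => measurable_const
  | r + 1, t, hM => by
    have ih := measurable_tailDensity (r := r) (t := t + 1)
      fun s hs hs' => hM s (by omega) (by omega)
    have h0 : Measurable fun q : State D × (Fin (r + 1) → State D) => q.2 0 := by fun_prop
    exact ((hM t le_rfl (by omega)).measurable_Q_comp measurable_fst h0).mul
      (ih.comp (f := fun q : State D × (Fin (r + 1) → State D) =>
        (q.2 0, (Fin.tail q.2 : Fin r → State D)))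
        (h0.prodMk (measurable_tail.comp measurable_snd)))

lemma tailDensity_ne_top : ∀ (r t : ℕ) (y : State D) (x : Fin r → State D),
    tailDensity M r t y x ≠ ∞
  | 0, _, _, _ => ENNReal.one_ne_top
  | r + 1, t, _, _ => ENNReal.mul_ne_top ENNReal.ofReal_ne_top (tailDensity_ne_top r (t + 1) _ _)

/-- Gibbs update: given the later states `x`, the index has weights `v k`, up to a factor `R` free
of `k`, and backward sampling draws from exactly these weights. -/
lemma sum_mul_backwardProb {t : ℕ} (hM : M.Regular (t + 1)) {g : Generation D N}
    (hg : g.Nondegenerate) {r : ℕ} (x : Fin (r + 1) → State D) (F : Fin (N + 1) → ℝ≥0∞) :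
    ∑ k, g.weight k * (tailDensity M (r + 1) (t + 1) (g.particle k) x *
        ∑ l, backwardProb M t g (x 0) l * F l) =
      ∑ k, g.weight k * (tailDensity M (r + 1) (t + 1) (g.particle k) x * F k) := by
  let v : Fin (N + 1) → ℝ≥0∞ := fun k =>
    g.weight k * ENNReal.ofReal (M.Q (t + 1) (g.particle k) (x 0))
  let R := tailDensity M r (t + 2) (x 0) (Fin.tail x)
  have hv : ∀ k (c : ℝ≥0∞),
      g.weight k * (tailDensity M (r + 1) (t + 1) (g.particle k) x * c) = v k * (R * c) := by
    intro k c
    simp only [tailDensity, v, R]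
    ring
  simp only [hv]
  rw [← Finset.sum_mul, mul_left_comm, Finset.mul_sum, Finset.mul_sum]
  refine Finset.sum_congr rfl fun l _ => ?_
  rw [← mul_assoc (∑ k, v k), backwardProb, sum_mul_normalise
    (fun i => hM.backwardWeight_ne_zero hg _ i) fun i => backwardWeight_ne_top M t hg _ i]
  ring

/-- The path returned by the algorithm has the same law as the reference path, if the reference
index before time `t` is drawn according to the weights. -/
def PathInvariance (M : Model D) (N r t : ℕ) : Prop :=
  ∀ (p : Fin (N + 1) → State D) (w : Fin (N + 1) → ℝ≥0∞), (∀ n, w n ≠ 0 ∧ w n ≠ ∞) →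
    (1 < t ∨ p = 0) → ∀ F : (Fin r → State D) → ℝ≥0∞, Measurable F →
      ∑ k, normalise w k * ∫⁻ x, tailDensity M r t (p k) x *
          ∫⁻ x', F x' ∂runFrom M r t ((k, p, w) : Generation D N) x =
        ∑ k, normalise w k * ∫⁻ x, tailDensity M r t (p k) x * F x

lemma sum_lintegral_selectFrom (hN : 1 ≤ N) {r t : ℕ} (ht : 0 < t)
    (hM : ∀ s, t ≤ s → s < t + (r + 1) → M.Regular s) (ih : PathInvariance M N r (t + 1))
    {z : Fin (N + 1) → State D} {w : Fin (N + 1) → ℝ≥0∞} (hw : ∀ n, w n ≠ 0 ∧ w n ≠ ∞)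
    {F : (Fin (r + 1) → State D) → ℝ≥0∞} (hF : Measurable F) :
    ∑ k, normalise w k * ∫⁻ x, tailDensity M r (t + 1) (z k) x *
        ∫⁻ x', F x' ∂selectFrom M r t ((k, z, w) : Generation D N) x =
      ∑ k, normalise w k * ∫⁻ x, tailDensity M r (t + 1) (z k) x *
        F (Fin.cons (z k) x : Fin (r + 1) → State D) := by
  cases r with
  | zero =>
    simp only [lintegral_pi_fin_zero, tailDensity, one_mul, selectFrom,
      fun h : Generation D N => lintegral_finalLaw h hF]
    have h := sum_forcedMove hN (W := normalise w)
      (normalise_ne_zero (fun n => (hw n).1) fun n => (hw n).2)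
      (sum_normalise (fun n => (hw n).1) fun n => (hw n).2) fun l => F fun _ => z l
    refine h.trans (Finset.sum_congr rfl fun k _ => ?_)
    congr 2
    ext i
    rw [Fin.fin_one_eq_zero i, Fin.cons_zero]
  | succ r =>
    have hM' := hM (t + 1) (by omega) (by omega)
    -- Backward sampling ignores the reference index, here set to `0`; so `B` is the same for all
    -- `k` and can serve as test function in `ih`.
    let B : (Fin (r + 1) → State D) → ℝ≥0∞ := fun x' =>
      ∑ l, backwardProb M t ((0, z, w) : Generation D N) (x' 0) l *
        F (Fin.cons (z l) x' : Fin (r + 2) → State D)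
    have hstep : ∀ k, Measurable fun x' : Fin (r + 1) → State D =>
        backwardStep M t ((k, z, w) : Generation D N) x' := fun k =>
      hM'.measurable_backwardStep.comp
        (f := fun x' : Fin (r + 1) → State D => (((k, z, w) : Generation D N), x'))
        measurable_prodMk_left
    have hBeq : ∀ k x', ∫⁻ x, F x ∂backwardStep M t ((k, z, w) : Generation D N) x' = B x' :=
      fun k x' => lintegral_backwardStep M t _ x' hF
    have hB : Measurable B := by
      rw [← funext (hBeq 0)]
      exact (Measure.measurable_lintegral hF).comp (hstep 0)
    have hsel : ∀ k x, ∫⁻ x', F x' ∂selectFrom M (r + 1) t ((k, z, w) : Generation D N) x =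
        ∫⁻ x', B x' ∂runFrom M (r + 1) (t + 1) ((k, z, w) : Generation D N) x := by
      intro k x
      rw [selectFrom, lintegral_bind_of_measurable (hstep k) hF]
      exact lintegral_congr fun x' => hBeq k x'
    simp only [hsel]
    rw [ih z w hw (Or.inl (by omega)) B hB]
    have hγ : ∀ k, Measurable fun x => tailDensity M (r + 1) (t + 1) (z k) x := fun k =>
      (measurable_tailDensity fun s hs hs' => hM s (by omega) (by omega)).comp
        (f := fun x : Fin (r + 1) → State D => (z k, x)) measurable_prodMk_left
    have hFc : ∀ k, Measurable fun x => F (Fin.cons (z k) x : Fin (r + 2) → State D) := fun k =>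
      hF.comp (measurable_cons.comp measurable_prodMk_left)
    rw [sum_mul_lintegral _ (fun k x => tailDensity M (r + 1) (t + 1) (z k) x * B x)
        fun k => (hγ k).mul hB,
      sum_mul_lintegral _ (fun k x => tailDensity M (r + 1) (t + 1) (z k) x *
        F (Fin.cons (z k) x : Fin (r + 2) → State D)) fun k => (hγ k).mul (hFc k)]
    exact lintegral_congr fun x => sum_mul_backwardProb hM'
      (g := ((0, z, w) : Generation D N)) hw x fun l => F (Fin.cons (z l) x : Fin (r + 2) → State D)

end Invariance

/-! ### Induction over time; total mass. -/

section Induction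

variable {D N : ℕ} {M : Model D}

lemma pathInvariance_succ (hN : 1 ≤ N) {r t : ℕ} (ht : 0 < t)
    (hM : ∀ s, t ≤ s → s < t + (r + 1) → M.Regular s) (ih : PathInvariance M N r (t + 1)) :
    PathInvariance M N (r + 1) t := by
  intro p w hw hpt F hF
  have hMt := hM t le_rfl (by omega)
  have hγ : Measurable fun q : State D × (Fin r → State D) => tailDensity M r (t + 1) q.1 q.2 :=
    measurable_tailDensity fun s hs hs' => hM s (by omega) (by omega)
  have hγ' : Measurable fun q : State D × (Fin (r + 1) → State D) =>
    tailDensity M (r + 1) t q.1 q.2 := measurable_tailDensity hM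
  have hsel : Measurable fun q : Generation D N × (Fin r → State D) =>
      ∫⁻ x', F x' ∂selectFrom M r t q.1 q.2 :=
    (Measure.measurable_lintegral hF).comp (measurable_selectFrom' hM)
  have hrun : Measurable fun q : Generation D N × (Fin (r + 1) → State D) =>
      ∫⁻ x', F x' ∂runFrom M (r + 1) t q.1 q.2 :=
    (Measure.measurable_lintegral hF).comp (measurable_runFrom hM)
  -- `Ψ` and `Φ` integrate out the reference states after time `t`, so that each side becomes an
  -- integral over the reference state and the generation at time `t`.
  let Ψ : State D → Generation D N → ℝ≥0∞ := fun x h =>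
    ∫⁻ xs, tailDensity M r (t + 1) x xs * ∫⁻ x', F x' ∂selectFrom M r t h xs
  let Φ : State D → ℝ≥0∞ := fun x =>
    ∫⁻ xs, tailDensity M r (t + 1) x xs * F (Fin.cons x xs : Fin (r + 1) → State D)
  have hΨ : Measurable (Function.uncurry Ψ) :=
    Measurable.lintegral_prod_right' (f := fun q : (State D × Generation D N) ×
      (Fin r → State D) => tailDensity M r (t + 1) q.1.1 q.2 *
        ∫⁻ x', F x' ∂selectFrom M r t q.1.2 q.2)
      ((hγ.comp (f := fun q : (State D × Generation D N) × (Fin r → State D) => (q.1.1, q.2))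
        (by fun_prop)).mul
        (hsel.comp (f := fun q : (State D × Generation D N) × (Fin r → State D) => (q.1.2, q.2))
          (by fun_prop)))
  have hΦ : Measurable Φ :=
    Measurable.lintegral_prod_right' (f := fun q : State D × (Fin r → State D) =>
      tailDensity M r (t + 1) q.1 q.2 * F (Fin.cons q.1 q.2 : Fin (r + 1) → State D))
      (hγ.mul (hF.comp measurable_cons))
  have hleft : ∀ k, ∫⁻ x, tailDensity M (r + 1) t (p k) x *
        ∫⁻ x', F x' ∂runFrom M (r + 1) t ((k, p, w) : Generation D N) x =
      ∫⁻ x, ENNReal.ofReal (M.Q t (p k) x) *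
        ∫⁻ h, Ψ x h ∂generationLaw M t ((k, p, w) : Generation D N) x := by
    intro k
    have hint : Measurable fun x : Fin (r + 1) → State D => tailDensity M (r + 1) t (p k) x *
        ∫⁻ x', F x' ∂runFrom M (r + 1) t ((k, p, w) : Generation D N) x :=
      (hγ'.comp (f := fun x : Fin (r + 1) → State D => (p k, x)) measurable_prodMk_left).mul
        (hrun.comp (f := fun x : Fin (r + 1) → State D => (((k, p, w) : Generation D N), x))
          measurable_prodMk_left)
    rw [lintegral_cons hint]
    refine lintegral_congr fun x => ?_
    have : IsFiniteMeasure (generationLaw M t ((k, p, w) : Generation D N) x) :=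
      ⟨(hMt.generationLaw_univ_le_one _ x).trans_lt ENNReal.one_lt_top⟩
    have hjoint : Measurable fun q : Generation D N × (Fin r → State D) =>
        tailDensity M r (t + 1) x q.2 * ∫⁻ x', F x' ∂selectFrom M r t q.1 q.2 :=
      (hγ.comp (f := fun q : Generation D N × (Fin r → State D) => (x, q.2))
        (by fun_prop)).mul hsel
    rw [lintegral_lintegral_swap hjoint.aemeasurable, ← lintegral_const_mul' _ _
      ENNReal.ofReal_ne_top]
    refine lintegral_congr fun xs => ?_
    have hs : Measurable fun h : Generation D N => selectFrom M r t h xs :=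
      (measurable_selectFrom' hM).comp (f := fun h : Generation D N => (h, xs))
        measurable_prodMk_right
    rw [tailDensity, runFrom_succ, Fin.cons_zero, Fin.tail_cons,
      lintegral_bind_of_measurable hs hF, mul_assoc,
      lintegral_const_mul' _ _ (tailDensity_ne_top r (t + 1) _ _)]
  -- No generation occurs in this integral; one is inserted at no cost, as its law has mass one, so
  -- that the exchange lemma applies to both sides.
  have hright : ∀ k, ∫⁻ x, tailDensity M (r + 1) t (p k) x * F x =
      ∫⁻ x, ENNReal.ofReal (M.Q t (p k) x) *
        ∫⁻ _h, Φ x ∂generationLaw M t ((k, p, w) : Generation D N) x := by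
    intro k
    have hint : Measurable fun x : Fin (r + 1) → State D => tailDensity M (r + 1) t (p k) x * F x :=
      (hγ'.comp (f := fun x : Fin (r + 1) → State D => (p k, x)) measurable_prodMk_left).mul hF
    rw [lintegral_cons hint]
    refine lintegral_congr fun x => ?_
    rw [lintegral_const, hMt.generationLaw_univ (g := ((k, p, w) : Generation D N)) hw hpt, mul_one,
      ← lintegral_const_mul' _ _ ENNReal.ofReal_ne_top]
    refine lintegral_congr fun xs => ?_
    rw [tailDensity, Fin.cons_zero, Fin.tail_cons, mul_assoc]
  simp only [hleft, hright]
  rw [hMt.sum_lintegral_generationLaw hw hpt hΨ,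
    hMt.sum_lintegral_generationLaw hw hpt (F := fun x _ => Φ x) (hΦ.comp measurable_fst)]
  congr 1
  refine Finset.sum_congr rfl fun a _ => congrArg _ (lintegral_congr fun z => ?_)
  have h0 := hMt.unnormalisedWeight_ne_zero (fun n => p (a n)) z
  have htop := hMt.unnormalisedWeight_ne_top (fun n => p (a n)) z
  -- Factoring out the total weight turns `w_t^k` into the probabilities `W_t^k`, and the claim
  -- becomes the invariance of selection for fixed particles.
  have hpull : ∀ G : Fin (N + 1) → ℝ≥0∞,
      ∑ k, unnormalisedWeight M t (fun n => p (a n)) z k * G k =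
        (∑ k, unnormalisedWeight M t (fun n => p (a n)) z k) *
          ∑ k, normalise (unnormalisedWeight M t (fun n => p (a n)) z) k * G k := by
    intro G
    rw [Finset.mul_sum]
    exact Finset.sum_congr rfl fun k _ => by rw [← mul_assoc, sum_mul_normalise h0 htop]
  rw [hpull, hpull]
  exact congrArg _ (sum_lintegral_selectFrom hN ht hM ih (fun n => ⟨h0 n, htop n⟩) hF)

lemma pathInvariance (hN : 1 ≤ N) : ∀ {r t : ℕ} (_ : 0 < t)
    (_ : ∀ s, t ≤ s → s < t + r → M.Regular s), PathInvariance M N r t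
  | 0, t, _, _ => by
    intro p w _ _ F hF
    simp only [runFrom, lintegral_dirac' _ hF, lintegral_pi_fin_zero]
  | r + 1, t, ht, hM =>
    pathInvariance_succ hN ht hM (pathInvariance hN (by omega)
      fun s hs hs' => hM s (by omega) (by omega))

lemma selectFrom_univ (hN : 1 ≤ N) {r t : ℕ} (hM : ∀ s, t ≤ s → s < t + (r + 1) → M.Regular s)
    {h : Generation D N} (hh : h.Nondegenerate) (x : Fin r → State D)
    (ih : runFrom M r (t + 1) h x Set.univ = 1) : selectFrom M r t h x Set.univ = 1 := by
  cases r with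
  | zero =>
    rw [selectFrom, finalLaw_univ, forcedMove_univ]
    exact sum_erase_div hN hh.weight_ne_zero hh.sum_weight _
  | succ r =>
    have hM' := hM (t + 1) (by omega) (by omega)
    have hm : Measurable fun x' : Fin (r + 1) → State D => backwardStep M t h x' :=
      hM'.measurable_backwardStep.comp (f := fun x' : Fin (r + 1) → State D => (h, x'))
        measurable_prodMk_left
    rw [selectFrom, Measure.bind_apply MeasurableSet.univ hm.aemeasurable]
    have h1 : ∀ x' : Fin (r + 1) → State D, backwardStep M t h x' Set.univ = 1 := fun x' => by
      rw [backwardStep_univ]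
      exact sum_normalise (fun i => hM'.backwardWeight_ne_zero hh _ i)
        fun i => backwardWeight_ne_top M t hh _ i
    simp only [h1, lintegral_one, ih]

lemma runFrom_univ (hN : 1 ≤ N) : ∀ {r t : ℕ} (_ : ∀ s, t ≤ s → s < t + r → M.Regular s)
    {g : Generation D N} (_ : g.Nondegenerate) (_ : 0 < t) (_ : 1 < t ∨ g.particle = 0)
    (x : Fin r → State D), runFrom M r t g x Set.univ = 1
  | 0, _, _, _, _, _, _, _ => by simp [runFrom]
  | r + 1, t, hM, g, hg, ht, hgt, x => by
    have hMt := hM t le_rfl (by omega)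
    have hs : Measurable fun h : Generation D N => selectFrom M r t h (Fin.tail x) :=
      (measurable_selectFrom' hM).comp
        (f := fun h : Generation D N => (h, (Fin.tail x : Fin r → State D)))
        measurable_prodMk_right
    have hs' : Measurable fun h : Generation D N => selectFrom M r t h (Fin.tail x) Set.univ :=
      (Measure.measurable_coe MeasurableSet.univ).comp hs
    rw [runFrom_succ, Measure.bind_apply MeasurableSet.univ hs.aemeasurable,
      ← hMt.generationLaw_univ hg hgt (x 0), ← lintegral_one,
      hMt.lintegral_generationLaw_eq_sum hg hgt _ hs',
      hMt.lintegral_generationLaw_eq_sum hg hgt _ measurable_const]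
    refine Finset.sum_congr rfl fun k _ => congrArg _ (Finset.sum_congr rfl fun a _ =>
      congrArg _ ?_)
    rw [hMt.lintegral_generationLawOfParents _ _ _ hs',
      hMt.lintegral_generationLawOfParents _ _ _ measurable_const]
    refine lintegral_congr fun z => congrArg _ ?_
    have hh : Generation.Nondegenerate ((k, k.insertNth (α := fun _ => State D) (x 0) z,
        unnormalisedWeight M t (fun n => g.particle (a n))
          (k.insertNth (α := fun _ => State D) (x 0) z)) : Generation D N) := fun n =>
      ⟨hMt.unnormalisedWeight_ne_zero (fun n => g.particle (a n)) _ n,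
        hMt.unnormalisedWeight_ne_top (fun n => g.particle (a n)) _ n⟩
    exact selectFrom_univ hN hM hh _ (runFrom_univ hN (fun s hs hs' => hM s (by omega) (by omega))
      hh (by omega) (Or.inl (by omega)) _)

end Induction

/-! ### The target and the whole algorithm. -/

section Target

variable {D : ℕ} {M : Model D}

lemma tailDensity_eq_prod : ∀ (r t : ℕ) (y : State D) (x : Fin r → State D),
    tailDensity M r t y x = ∏ i : Fin r, ENNReal.ofReal
      (M.Q (t + i) ((Fin.cons y x : Fin (r + 1) → State D) i.castSucc) (x i))
  | 0, _, _, _ => by simp [tailDensity]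
  | r + 1, t, y, x => by
    rw [tailDensity, tailDensity_eq_prod r, Fin.prod_univ_succ]
    refine congrArg₂ _ (by simp) (Finset.prod_congr rfl fun i _ => ?_)
    rw [Fin.castSucc_succ, Fin.cons_succ, ← Fin.cons_self_tail x, Fin.tail_cons, Fin.cons_succ,
      Fin.cons_zero]
    congr 2
    simp only [Fin.val_succ]
    omega

lemma ofReal_unnormalisedTarget {T : ℕ} (hM : ∀ s, 1 ≤ s → s < 1 + T → M.Regular s)
    (x : Fin T → State D) :
    ENNReal.ofReal (unnormalisedTarget M T x) = tailDensity M T 1 0 x := by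
  rw [unnormalisedTarget, tailDensity_eq_prod, ENNReal.ofReal_prod_of_nonneg]
  · simp only [add_comm]
  · exact fun i _ => ((hM _ (by omega) (by omega)).Q_pos _ _).le

lemma unnormalisedTarget_pos {T : ℕ} (hM : ∀ s, 1 ≤ s → s < 1 + T → M.Regular s)
    (x : Fin T → State D) : 0 < unnormalisedTarget M T x :=
  Finset.prod_pos fun _ _ => (hM _ (by omega) (by omega)).Q_pos _ _

lemma lintegral_unnormalisedTarget_ne_zero {T : ℕ}
    (hM : ∀ s, 1 ≤ s → s < 1 + T → M.Regular s) :
    ∫⁻ x, ENNReal.ofReal (unnormalisedTarget M T x) ≠ 0 := by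
  have hm : Measurable fun x => ENNReal.ofReal (unnormalisedTarget M T x) := by
    simp only [ofReal_unnormalisedTarget hM]
    exact (measurable_tailDensity hM).comp measurable_prodMk_left
  refine ((lintegral_pos_iff_support hm).mpr ?_).ne'
  have : (Function.support fun x => ENNReal.ofReal (unnormalisedTarget M T x)) = Set.univ :=
    Set.eq_univ_of_forall fun x => (ENNReal.ofReal_pos.mpr (unnormalisedTarget_pos hM x)).ne'
  exact this ▸ Measure.measure_univ_pos.mpr (NeZero.ne _)

lemma isProbabilityMeasure_target {T : ℕ} (hM : ∀ s, 1 ≤ s → s < 1 + T → M.Regular s)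
    (hint : Integrable (unnormalisedTarget M T)) : IsProbabilityMeasure (target M T) := by
  constructor
  rw [target, Measure.smul_apply, withDensity_apply _ MeasurableSet.univ, Measure.restrict_univ,
    smul_eq_mul]
  exact ENNReal.inv_mul_cancel (lintegral_unnormalisedTarget_ne_zero hM)
    hint.lintegral_lt_top.ne

/-- The first step never consults the preceding generation, so the dummy with weights `0` may be
replaced by a nondegenerate one with weights `1` and any reference index. -/
lemma algorithmLaw_eq {N T : ℕ} (hT : 1 ≤ T) (k : Fin (N + 1)) (x : Fin T → State D) :
    algorithmLaw M N T x = runFrom M T 1 ((k, 0, 1) : Generation D N) x := by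
  obtain ⟨r, rfl⟩ := Nat.exists_eq_add_of_le' hT
  rw [algorithmLaw, runFrom_succ, runFrom_succ]
  rfl

lemma nondegenerate_dummy {N : ℕ} (k : Fin (N + 1)) :
    Generation.Nondegenerate ((k, 0, 1) : Generation D N) :=
  fun _ => ⟨one_ne_zero, ENNReal.one_ne_top⟩

lemma lintegral_tailDensity_algorithmLaw {N T : ℕ} (hN : 1 ≤ N) (hT : 1 ≤ T)
    (hM : ∀ s, 1 ≤ s → s < 1 + T → M.Regular s) {F : (Fin T → State D) → ℝ≥0∞}
    (hF : Measurable F) :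
    ∫⁻ x, tailDensity M T 1 0 x * ∫⁻ x', F x' ∂algorithmLaw M N T x =
      ∫⁻ x, tailDensity M T 1 0 x * F x := by
  have h := pathInvariance hN Nat.one_pos hM 0 (1 : Fin (N + 1) → ℝ≥0∞)
    (fun _ => ⟨one_ne_zero, ENNReal.one_ne_top⟩) (Or.inr rfl) F hF
  -- All summands now agree, because neither the dummy particle nor the algorithm depends on `k`;
  -- the weights sum to one.
  simp only [← algorithmLaw_eq hT, Pi.zero_apply] at h
  rwa [← Finset.sum_mul, ← Finset.sum_mul,
    sum_normalise (w := 1) (fun _ => one_ne_zero) fun _ => ENNReal.one_ne_top, one_mul, one_mul] at h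

lemma measurable_algorithmLaw {N T : ℕ} (hM : ∀ s, 1 ≤ s → s < 1 + T → M.Regular s) :
    Measurable fun x => algorithmLaw M N T x :=
  (measurable_runFrom hM).comp
    (f := fun x : Fin T → State D => (((0, 0, 0) : Generation D N), x)) measurable_prodMk_left

lemma algorithmLaw_univ {N T : ℕ} (hN : 1 ≤ N) (hT : 1 ≤ T)
    (hM : ∀ s, 1 ≤ s → s < 1 + T → M.Regular s) (x : Fin T → State D) :
    algorithmLaw M N T x Set.univ = 1 := by
  rw [algorithmLaw_eq hT 0]
  exact runFrom_univ hN hM (nondegenerate_dummy 0) Nat.one_pos (Or.inr rfl) x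

lemma bind_algorithmLaw_target {N T : ℕ} (hN : 1 ≤ N) (hT : 1 ≤ T)
    (hM : ∀ s, 1 ≤ s → s < 1 + T → M.Regular s) :
    (target M T).bind (fun x => algorithmLaw M N T x) = target M T := by
  have hγ : Measurable fun x => tailDensity M T 1 0 x :=
    (measurable_tailDensity hM).comp measurable_prodMk_left
  have htarget : ∀ F : (Fin T → State D) → ℝ≥0∞, Measurable F → ∫⁻ x, F x ∂target M T =
      (∫⁻ x, tailDensity M T 1 0 x)⁻¹ * ∫⁻ x, tailDensity M T 1 0 x * F x := by
    intro F hF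
    simp only [target, ofReal_unnormalisedTarget hM, lintegral_smul_measure, smul_eq_mul]
    rw [lintegral_withDensity_eq_lintegral_mul _ hγ hF]
    rfl
  have hP := measurable_algorithmLaw (N := N) hM
  refine Measure.ext_of_lintegral _ fun F hF => ?_
  rw [lintegral_bind_of_measurable hP hF,
    htarget (fun x => ∫⁻ x', F x' ∂algorithmLaw M N T x)
      ((Measure.measurable_lintegral hF).comp hP),
    htarget F hF, lintegral_tailDensity_algorithmLaw hN hT hM hF]

end Target

end MarginalCSMC

theorem mainTheorem3 (D N T : ℕ) (hN : 1 ≤ N) (hT : 1 ≤ T) (M : MarginalCSMC.Model D)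
    (hQ_pos : ∀ t ∈ Finset.Icc 1 T, ∀ x y, 0 < M.Q t x y)
    (hQ_meas : ∀ t ∈ Finset.Icc 1 T, Measurable (Function.uncurry (M.Q t)))
    (hQ_int : MeasureTheory.Integrable (MarginalCSMC.unnormalisedTarget M T))
    (hphi_meas : ∀ t ∈ Finset.Icc 1 T, Measurable (Function.uncurry (M.phi t)))
    (hv_meas : ∀ t ∈ Finset.Icc 1 T, Measurable (M.v t))
    (hE : ∀ t ∈ Finset.Icc 1 T, (M.E t).PosDef)
    (hD : ∀ t ∈ Finset.Icc 1 T, (M.Dm t).PosDef) :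
    MeasureTheory.IsProbabilityMeasure (MarginalCSMC.target M T) ∧
    ∃ P : ProbabilityTheory.Kernel (Fin T → MarginalCSMC.State D) (Fin T → MarginalCSMC.State D),
      (∀ x, P x = MarginalCSMC.algorithmLaw M N T x) ∧
      ProbabilityTheory.IsMarkovKernel P ∧
      P.Invariant (MarginalCSMC.target M T) := by
  have hM : ∀ s, 1 ≤ s → s < 1 + T → M.Regular s := fun s h h' => by
    have hs : s ∈ Finset.Icc 1 T := Finset.mem_Icc.mpr ⟨h, by omega⟩
    exact ⟨hQ_pos s hs, hQ_meas s hs, hphi_meas s hs, hv_meas s hs, hE s hs, hD s hs⟩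
  exact ⟨MarginalCSMC.isProbabilityMeasure_target hM hQ_int,
    ⟨fun x => MarginalCSMC.algorithmLaw M N T x, MarginalCSMC.measurable_algorithmLaw hM⟩,
    fun _ => rfl, ⟨fun x => ⟨MarginalCSMC.algorithmLaw_univ hN hT hM x⟩⟩,
    MarginalCSMC.bind_algorithmLaw_target hN hT hM⟩
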